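/- **Proposition 1 (Filter invertibility).** Let $\theta=(\alpha,\pi,c,b,a)'$ and let $\Theta\subset\{\theta\in\mathbb{R}^5:\alpha\ge 0,\ 0\le\pi<1\}$ be compact. For $f\in\mathbb{R}$ let $$s(0,f,\theta)=\frac{(\pi-1)\exp(f)}{(\alpha\exp(f)+1)\left(1+\pi(\alpha\exp(f)+1)^{\alpha^{-1}}-\pi\right)},\qquad s(x,f,\theta)=\frac{x-\exp(f)}{\alpha\exp(f)+1}\quad(x=1,2,\ldots)$$ be the score (with unit scaling) of the zero-inflated negative binomial distribution with respect to $f=\log\mu$, where $\mu$ is the location parameter, $\alpha$ the dispersion parameter and $\pi$ the probability of excessive zeros; for $\alpha=0$ (the zero-inflated Poisson distribution) $(\alpha\exp(f)+1)^{\alpha^{-1}}$ stands for its limit $\exp(\exp(f))$. Let the data $\{x_i\}_{i\in\mathbb{Z}}$ be a strictly stationary and ergodic sequence of random variables with values in $\{0,1,2,\ldots\}$, and let $\hat f_1:\Theta\to\mathbb{R}$ be a continuous initialization (for instance, a given real number). Write $\mathrm{E}_{x_i>0}[\cdot]=\mathrm{E}[\cdot\mid x_i>0]$, and suppose that (i)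 $\log^{+}\sup_{\theta\in\Theta}|s(0,\hat f_1(\theta),\theta)|<\infty$; (ii) $\mathrm{E}_{x_i>0}\left[\log^{+}\sup_{\theta\in\Theta}|s(x_i,\hat f_1(\theta),\theta)|\right]<\infty$; (iii) $\displaystyle \mathrm{P}[x_i=0]\cdot\log\sup_{f\in\mathbb{R}}\sup_{\theta\in\Theta}\left|a\frac{\partial s(0,f,\theta)}{\partial f}+b\right|+\mathrm{P}[x_i>0]\cdot\mathrm{E}_{x_i>0}\left[\log\sup_{f\in\mathbb{R}}\sup_{\theta\in\Theta}\left|a\frac{\partial s(x_i,f,\theta)}{\partial f}+b\right|\right]<0$ (suprema, logarithms and expectations are taken in the extended real numbers; a term whose probability is zero is absent). Then the filter $\hat f_{i+1}(\theta)=c+b\hat f_i(\theta)+a\,s(x_i,\hat f_i(\theta),\theta)$, $i=1,2,\ldots$, is invertible, uniformly in $\theta\in\Theta$. That is, there is a sequence $\{f_i\}_{i\in\mathbb{Z}}$ of random elements of the space $C(\Theta,\mathbb{R})$ of continuous functions on $\Theta$ that is strictly stationary and ergodic, also jointly with the data, that solves $f_{i+1}(\theta)=c+bf_i(\theta)+a\,s(x_i,f_i(\theta),\theta)$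 for all $i\in\mathbb{Z}$, $\theta\in\Theta$ almost surely, and for which there is a constant $\gamma>1$ with $$\gamma^{i}\sup_{\theta\in\Theta}|\hat f_i(\theta)-f_i(\theta)|\to 0\quad\text{almost surely as } i\to\infty .$$ This limit is unique: a sequence $\{g_i\}_{i\in\mathbb{Z}}$ of random elements of $C(\Theta,\mathbb{R})$ equals $\{f_i\}_{i\in\mathbb{Z}}$ almost surely if $\{(x_i,g_i)\}_{i\in\mathbb{Z}}$ is strictly stationary and $\sup_{\theta\in\Theta}|\hat f_i(\theta)-g_i(\theta)|\to0$ almost surely, and also if $\{g_i\}_{i\in\mathbb{Z}}$ is strictly stationary and solves the recursion above. -/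

import Mathlib

open MeasureTheory ProbabilityTheory Filter Topology
open scoped ENNReal

namespace ZIACD

noncomputable section

/-! ### Strictly stationary and ergodic two-sided sequences -/

/-- The left shift on two-sided sequences. -/
def shift {E : Type*} (u : ℤ → E) : ℤ → E := fun i => u (i + 1)

/-- A sequence of random elements of `E` is strictly stationary: its law on the sequence space
(with the product sigma-algebra) is invariant under the shift. -/
def IsStationary {Ω E : Type*} [MeasurableSpace Ω] [MeasurableSpace E]
    (X : ℤ → Ω → E) (P : Measure Ω) : Prop :=
  (∀ i, Measurable (X i)) ∧
    MeasurePreserving (shift (E := E)) (P.map fun ω i => X i ω) (P.map fun ω i => X i ω)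

/-- A sequence of random elements of `E` is strictly stationary and ergodic: the shift is
measure preserving and ergodic for its law on the sequence space. -/
def IsStationaryErgodic {Ω E : Type*} [MeasurableSpace Ω] [MeasurableSpace E]
    (X : ℤ → Ω → E) (P : Measure Ω) : Prop :=
  (∀ i, Measurable (X i)) ∧ Ergodic (shift (E := E)) (P.map fun ω i => X i ω)

/-! ### The model -/

/-- The static parameter vector `θ = (α, π, c, b, a)`. -/
abbrev Param : Type := Fin 5 → ℝ

/-- The dispersion parameter `α`. -/
def dispersion (θ : Param) : ℝ := θ 0

/-- The probability `π` of excessive zeros. -/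
def inflation (θ : Param) : ℝ := θ 1

/-- The constant `c` of the recursion. -/
def const (θ : Param) : ℝ := θ 2

/-- The autoregressive parameter `b`. -/
def autoreg (θ : Param) : ℝ := θ 3

/-- The score parameter `a`. -/
def scoreCoef (θ : Param) : ℝ := θ 4

/-- The domain of the parameters of the zero-inflated negative binomial distribution:
`α ≥ 0` and `π ∈ [0, 1)`; the parameters `c`, `b`, `a` are arbitrary real numbers. -/
def Admissible (θ : Param) : Prop :=
  0 ≤ dispersion θ ∧ 0 ≤ inflation θ ∧ inflation θ < 1

/-- `(α m + 1) ^ (1 / α)`, the reciprocal of the probability of zero under the negative binomial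
distribution with mean `m` and dispersion `α`; for `α = 0` (the Poisson distribution) it is the
limit `exp m`. -/
def invZeroProb (α m : ℝ) : ℝ :=
  if α = 0 then Real.exp m else (α * m + 1) ^ α⁻¹

/-- The score `s(x, f, θ)` with unit scaling of the zero-inflated negative binomial distribution,
with respect to the logarithm `f` of the location parameter. -/
def score (x : ℕ) (f : ℝ) (θ : Param) : ℝ :=
  if x = 0 then
    (inflation θ - 1) * Real.exp f /
      ((dispersion θ * Real.exp f + 1) *
        (1 + inflation θ * invZeroProb (dispersion θ) (Real.exp f) - inflation θ))
  else (x - Real.exp f) / (dispersion θ * Real.exp f + 1)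

/-- The map `f ↦ c + b f + a s(x, f, θ)`. -/
def update (x : ℕ) (f : ℝ) (θ : Param) : ℝ :=
  const θ + autoreg θ * f + scoreCoef θ * score x f θ

/-- The filter initialized at `f₁`: `filter x f₁ n` is the `(n + 1)`-st element `f̂_{n+1}`, where
`f̂_1 = f₁` and `f̂_{i+1} = c + b f̂_i + a s(x_i, f̂_i, θ)` for `i = 1, 2, …`. -/
def filter {Ω : Type*} {Θ : Set Param} (x : ℤ → Ω → ℕ) (f₁ : C(Θ, ℝ)) : ℕ → Ω → Θ → ℝ
  | 0 => fun _ θ => f₁ θ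
  | n + 1 => fun ω θ => update (x (n + 1) ω) (filter x f₁ n ω θ) θ

/-! ### Logarithmic moments -/

/-- `log⁺ u = max (log u) 0` for `u ∈ [0, ∞]`. -/
def logPlus (u : ℝ≥0∞) : ℝ≥0∞ := (ENNReal.log u).toENNReal

/-- The expectation of an extended real random variable, the integral of the positive part minus
the integral of the negative part. It is `⊤` as soon as the positive part has infinite integral,
so that it is negative only if it exists and is negative. -/
def extExpectation {Ω : Type*} [MeasurableSpace Ω] (P : Measure Ω) (g : Ω → EReal) : EReal :=
  if ∫⁻ ω, (g ω).toENNReal ∂P = ⊤ then ⊤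
  else ((∫⁻ ω, (g ω).toENNReal ∂P : ℝ≥0∞) : EReal) - ((∫⁻ ω, (-(g ω)).toENNReal ∂P : ℝ≥0∞) : EReal)

/-- `sup_θ |s(k, f₁(θ), θ)|`, as an element of `[0, ∞]`. -/
def supScore {Θ : Set Param} (f₁ : C(Θ, ℝ)) (k : ℕ) : ℝ≥0∞ :=
  ⨆ θ : Θ, ‖score k (f₁ θ) θ‖ₑ

/-- `log sup_f sup_θ |a ∂s(k, f, θ)/∂f + b|`, as an element of `[-∞, ∞]`. -/
def logContraction (Θ : Set Param) (k : ℕ) : EReal :=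
  ENNReal.log (⨆ f : ℝ, ⨆ θ : Θ,
    ‖scoreCoef θ * deriv (fun u : ℝ => score k u θ) f + autoreg θ‖ₑ)

/-! ### Invertibility -/

/-- Random continuous functions on `Θ` are measurable for the Borel sigma-algebra of the topology
of uniform convergence on compact sets (of the supremum norm, when `Θ` is compact). -/
instance (Θ : Set Param) : MeasurableSpace C(Θ, ℝ) := borel _

instance (Θ : Set Param) : BorelSpace C(Θ, ℝ) := ⟨rfl⟩

/-- `sup_θ |f̂_{n+1}(θ) - g_{n+1}(θ)|`, as an element of `[0, ∞]`. -/
def supDist {Ω : Type*} {Θ : Set Param} (x : ℤ → Ω → ℕ) (f₁ : C(Θ, ℝ)) (g : ℤ → Ω → C(Θ, ℝ))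
    (n : ℕ) (ω : Ω) : ℝ≥0∞ :=
  ⨆ θ : Θ, ‖filter x f₁ n ω θ - g (n + 1) ω θ‖ₑ

/-- `f` is a solution of the recursion `f_{i+1} = c + b f_i + a s(x_i, f_i, θ)`, `i ∈ ℤ`. -/
def SolvesRecursion {Ω : Type*} [MeasurableSpace Ω] {Θ : Set Param} (P : Measure Ω)
    (x : ℤ → Ω → ℕ) (f : ℤ → Ω → C(Θ, ℝ)) : Prop :=
  ∀ᵐ ω ∂P, ∀ (i : ℤ) (θ : Θ), f (i + 1) ω θ = update (x i ω) (f i ω θ) θ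

/-- The filter initialized at `f₁` is invertible, uniformly in `θ ∈ Θ`: it converges almost surely
exponentially fast, uniformly in `θ`, to a strictly stationary and ergodic sequence, and this limit
is unique. The limit solves the recursion of the filter and is stationary and ergodic jointly with
the data. It is unique, up to a null set, both among the sequences which are stationary jointly with
the data and to which the filter converges (at whatever rate), and among the stationary solutions
of the recursion. -/
def IsUniformlyInvertible {Ω : Type*} [MeasurableSpace Ω] {Θ : Set Param} (P : Measure Ω)
    (x : ℤ → Ω → ℕ) (f₁ : C(Θ, ℝ)) : Prop :=
  ∃ f : ℤ → Ω → C(Θ, ℝ),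
    IsStationaryErgodic f P ∧
    IsStationaryErgodic (fun i ω => (x i ω, f i ω)) P ∧
    SolvesRecursion P x f ∧
    (∃ γ : ℝ, 1 < γ ∧
      ∀ᵐ ω ∂P, Tendsto (fun n : ℕ => ENNReal.ofReal (γ ^ n) * supDist x f₁ f n ω) atTop (𝓝 0)) ∧
    (∀ g : ℤ → Ω → C(Θ, ℝ),
      IsStationary (fun i ω => (x i ω, g i ω)) P →
      (∀ᵐ ω ∂P, Tendsto (fun n : ℕ => supDist x f₁ g n ω) atTop (𝓝 0)) →
      ∀ᵐ ω ∂P, ∀ i, g i ω = f i ω) ∧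
    (∀ g : ℤ → Ω → C(Θ, ℝ),
      IsStationary g P → SolvesRecursion P x g → ∀ᵐ ω ∂P, ∀ i, g i ω = f i ω)

end

end ZIACD

/-! The filter iterates the random maps `updateMap (x i)` on `C(Θ, ℝ)`, a complete separable metric
space since `Θ` is compact. By the mean value inequality, `sup |a ∂s/∂f + b|` is a Lipschitz
constant of such a map, and (iii) says that its logarithm has negative mean. By ergodicity, products
of consecutive Lipschitz constants then decay exponentially, both forward and backward in time. Only
this upper bound on Birkhoff sums is needed, and a maximal-function argument gives it
(`exists_birkhoffSum_le`).

By (i) and (ii) one update moves `f₁` by a distance with a logarithmic moment, so this distance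
grows subexponentially along the data. Hence the iterations started from `f₁` at ever earlier times
form a Cauchy sequence. Their limit is a measurable functional of the data that solves the recursion
(`exists_stationary_solution`); as a factor of the data it is stationary and ergodic. Forward
contraction makes the filter converge to it exponentially fast.

Uniqueness rests on stationarity: a distance whose law does not depend on time and which tends to
zero vanishes (`ae_eq_of_tendsto_dist`), and two stationary solutions cannot start far apart in the
remote past with non-negligible probability (`ae_eq_of_solutions`).

Specific to the model are the continuity of the score up to `α = 0` and a lower bound on the
contraction coefficient, uniform in the observation, which keeps its logarithm integrable
(`exists_pos_le_contraction`). -/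

namespace ZIACD

/-! ### Birkhoff sums with negative drift -/

section Maximal

variable {α : Type*} {T : α → α} {h : α → ℝ}

/-- The running maximum of `0` and the first `n` Birkhoff sums. -/
def runningMax (T : α → α) (h : α → ℝ) : ℕ → α → ℝ
  | 0 => fun _ => 0
  | n + 1 => fun u => max 0 (h u + runningMax T h n (T u))

lemma runningMax_nonneg (n : ℕ) (u : α) : 0 ≤ runningMax T h n u := by
  cases n with
  | zero => exact le_rfl
  | succ n => exact le_max_left _ _

lemma runningMax_le_succ (n : ℕ) : ∀ u, runningMax T h n u ≤ runningMax T h (n + 1) u := by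
  induction n with
  | zero => exact fun u => runningMax_nonneg 1 u
  | succ n ih => exact fun u => max_le_max le_rfl (by linarith [ih (T u)])

lemma birkhoffSum_le_runningMax (n : ℕ) : ∀ u, birkhoffSum T h n u ≤ runningMax T h n u := by
  induction n with
  | zero => intro u; simp [runningMax]
  | succ n ih =>
    intro u
    rw [birkhoffSum_succ']
    exact le_max_of_le_right (by linarith [ih (T u)])

/-- Makes boundedness of the Birkhoff sums an invariant event, to which the zero-one law of
ergodicity applies. -/
lemma bddAbove_birkhoffSum_comp_iff (u : α) :
    BddAbove (Set.range fun n => birkhoffSum T h n (T u)) ↔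
      BddAbove (Set.range fun n => birkhoffSum T h n u) := by
  constructor
  · rintro ⟨C, hC⟩
    refine ⟨max 0 (h u + C), ?_⟩
    rintro _ ⟨n, rfl⟩
    cases n with
    | zero => simp
    | succ n =>
      have := hC ⟨n, rfl⟩
      simp only [birkhoffSum_succ'] at this ⊢
      exact le_max_of_le_right (by linarith)
  · rintro ⟨C, hC⟩
    refine ⟨C - h u, ?_⟩
    rintro _ ⟨n, rfl⟩
    have := hC ⟨n + 1, rfl⟩
    simp only [birkhoffSum_succ'] at this ⊢
    linarith

variable [MeasurableSpace α] {μ : Measure α}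

lemma integrable_runningMax [IsProbabilityMeasure μ] (hT : MeasurePreserving T μ μ)
    (hh : Integrable h μ) (n : ℕ) : Integrable (runningMax T h n) μ := by
  induction n with
  | zero => exact integrable_zero _ _ _
  | succ n ih =>
    exact (integrable_zero α ℝ μ).sup (hh.add (hT.integrable_comp_of_integrable ih))

/-- If almost every orbit has unbounded Birkhoff sums, the integral is nonnegative. -/
lemma integral_nonneg_of_not_bddAbove [IsProbabilityMeasure μ] (hT : MeasurePreserving T μ μ)
    (hh : Integrable h μ)
    (hub : ∀ᵐ u ∂μ, ¬ BddAbove (Set.range fun n => birkhoffSum T h n u)) :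
    0 ≤ ∫ u, h u ∂μ := by
  have hM := integrable_runningMax hT hh
  have hMT : ∀ n, Integrable (fun u => runningMax T h n (T u)) μ := fun n =>
    hT.integrable_comp_of_integrable (hM n)
  -- The integrand is `runningMax (n + 1) u - runningMax n (T u)`. It is dominated by `|h|`, and
  -- where the sums are unbounded it eventually equals `h u`. By invariance of `μ` its integral is
  -- that of `runningMax (n + 1) - runningMax n`, hence nonnegative.
  have hlim : Tendsto (fun n => ∫ u, max (-runningMax T h n (T u)) (h u) ∂μ) atTop
      (𝓝 (∫ u, h u ∂μ)) := by
    refine tendsto_integral_of_dominated_convergence (fun u => |h u|)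
      (fun n => ((hMT n).neg.sup hh).aestronglyMeasurable) hh.abs (fun n => ae_of_all _ fun u => ?_) ?_
    · have := runningMax_nonneg (T := T) (h := h) n (T u)
      rw [Real.norm_eq_abs, abs_le]
      refine ⟨le_max_of_le_right (neg_abs_le _), max_le ?_ (le_abs_self _)⟩
      linarith [abs_nonneg (h u)]
    · filter_upwards [hub] with u hu
      have hmono : Monotone fun n => runningMax T h n (T u) :=
        monotone_nat_of_le_succ fun n => runningMax_le_succ n (T u)
      rw [← bddAbove_birkhoffSum_comp_iff, not_bddAbove_iff] at hu
      obtain ⟨_, ⟨N, rfl⟩, hN⟩ := hu (-h u)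
      refine tendsto_const_nhds.congr' ?_
      filter_upwards [eventually_ge_atTop N] with n hn
      have h1 := hmono hn
      have h2 := birkhoffSum_le_runningMax (T := T) (h := h) N (T u)
      simp only at h1 hN
      exact (max_eq_right (by linarith)).symm
  refine ge_of_tendsto' hlim fun n => ?_
  have h1 : ∀ u, max (-runningMax T h n (T u)) (h u)
      = runningMax T h (n + 1) u - runningMax T h n (T u) := by
    intro u
    rw [runningMax, ← max_sub_sub_right, zero_sub, add_sub_cancel_right]
  simp_rw [h1]
  rw [integral_sub (hM _) (hMT _)]
  have h2 : ∫ u, runningMax T h n (T u) ∂μ = ∫ u, runningMax T h n u ∂μ := by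
    rw [← integral_map hT.measurable.aemeasurable (by rw [hT.map_eq]; exact (hM n).1), hT.map_eq]
  rw [h2, sub_nonneg]
  exact integral_mono (hM n) (hM (n + 1)) (runningMax_le_succ n)

lemma ae_bddAbove_birkhoffSum [IsProbabilityMeasure μ] (hT : Ergodic T μ) (hm : Measurable h)
    (hh : Integrable h μ) (hneg : ∫ u, h u ∂μ < 0) :
    ∀ᵐ u ∂μ, BddAbove (Set.range fun n => birkhoffSum T h n u) := by
  have hmeas : MeasurableSet {u | BddAbove (Set.range fun n => birkhoffSum T h n u)} := by
    refine measurableSet_bddAbove_range fun n => ?_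
    unfold birkhoffSum
    exact Finset.measurable_sum _ fun k _ => hm.comp (hT.measurable.iterate k)
  rcases hT.toPreErgodic.ae_mem_or_ae_notMem hmeas
    (Set.ext fun u => bddAbove_birkhoffSum_comp_iff u) with H | H
  · exact H
  · exact absurd hneg (not_lt.2 (integral_nonneg_of_not_bddAbove hT.toMeasurePreserving hh H))

/-- Birkhoff sums of a function with negative integral decrease at least linearly. -/
lemma exists_birkhoffSum_le [IsProbabilityMeasure μ] (hT : Ergodic T μ) (hm : Measurable h)
    (hh : Integrable h μ) {ε : ℝ} (hneg : ∫ u, h u ∂μ < -ε) :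
    ∀ᵐ u ∂μ, ∃ C : ℝ, ∀ n : ℕ, birkhoffSum T h n u ≤ C - n * ε := by
  -- The mean of `h + ε` is still negative; its bounded Birkhoff sums exceed those of `h` by `n *
  -- ε`.
  have := ae_bddAbove_birkhoffSum hT (hm.add_const ε) (hh.add (integrable_const ε)) (by
    rw [integral_add hh (integrable_const ε)]; simp; linarith)
  filter_upwards [this] with u ⟨C, hC⟩
  refine ⟨C, fun n => ?_⟩
  have := hC ⟨n, rfl⟩
  simp only [birkhoffSum, Finset.sum_add_distrib, Finset.sum_const, Finset.card_range,
    nsmul_eq_mul] at this ⊢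
  linarith

end Maximal

/-! ### Translations of two-sided sequences -/

section Translate

variable {E : Type*}

/-- The translation of a two-sided sequence by `n`. -/
def translate (n : ℤ) (u : ℤ → E) : ℤ → E := fun i => u (i + n)

@[simp] lemma translate_apply (n : ℤ) (u : ℤ → E) (i : ℤ) : translate n u i = u (i + n) := rfl

lemma translate_one : translate (E := E) 1 = shift := rfl

@[simp] lemma translate_zero (u : ℤ → E) : translate 0 u = u := by
  funext i; simp

lemma translate_translate (m n : ℤ) (u : ℤ → E) :
    translate m (translate n u) = translate (m + n) u := by
  funext i; simp [add_assoc]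

lemma iterate_translate (m : ℤ) (n : ℕ) (u : ℤ → E) :
    (translate m)^[n] u = translate (n * m) u := by
  induction n with
  | zero => simp
  | succ n ih =>
    rw [Function.iterate_succ_apply', ih, translate_translate]
    congr 1; push_cast; ring

variable [MeasurableSpace E]

lemma measurable_translate (n : ℤ) : Measurable (translate (E := E) n) :=
  measurable_pi_lambda _ fun i => measurable_pi_apply (i + n)

/-- The shift of two-sided sequences as a measurable equivalence. -/
def shiftEquiv : (ℤ → E) ≃ᵐ (ℤ → E) where
  toFun := translate 1
  invFun := translate (-1)
  left_inv u := by simp [translate_translate]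
  right_inv u := by simp [translate_translate]
  measurable_toFun := measurable_translate 1
  measurable_invFun := measurable_translate (-1)

variable {μ : Measure (ℤ → E)}

lemma measurePreserving_translate_neg_one (h : MeasurePreserving (shift (E := E)) μ μ) :
    MeasurePreserving (translate (E := E) (-1)) μ μ :=
  MeasurePreserving.symm (shiftEquiv (E := E)) h

lemma ergodic_translate_neg_one (h : Ergodic (shift (E := E)) μ) :
    Ergodic (translate (E := E) (-1)) μ :=
  Ergodic.symm (e := shiftEquiv (E := E)) h

lemma measurePreserving_translate (h : MeasurePreserving (shift (E := E)) μ μ) (n : ℤ) :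
    MeasurePreserving (translate (E := E) n) μ μ := by
  obtain ⟨k, rfl | rfl⟩ := n.eq_nat_or_neg
  · have := h.iterate k
    rw [← translate_one] at this
    convert this using 1
    funext u; simp [iterate_translate]
  · convert (measurePreserving_translate_neg_one h).iterate k using 1
    funext u; simp [iterate_translate]

lemma measurePreserving_translate_comp {Ω : Type*} [MeasurableSpace Ω] {P : Measure Ω}
    {X : ℤ → Ω → E} (h : IsStationary X P) (n : ℤ) :
    MeasurePreserving (fun ω => translate n fun i => X i ω) P (P.map fun ω i => X i ω) :=
  (measurePreserving_translate h.2 n).comp ⟨measurable_pi_lambda _ h.1, rfl⟩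

/-- A function of the translates of a stationary sequence has a constant law. -/
lemma measure_translate_preimage {Ω : Type*} [MeasurableSpace Ω] {P : Measure Ω}
    {X : ℤ → Ω → E} (h : IsStationary X P) {s : Set (ℤ → E)} (hs : MeasurableSet s) (n : ℤ) :
    P {ω | (translate n fun i => X i ω) ∈ s} = P {ω | (fun i => X i ω) ∈ s} := by
  have h0 := (measurePreserving_translate_comp h 0).measure_preimage hs.nullMeasurableSet
  have hn := (measurePreserving_translate_comp h n).measure_preimage hs.nullMeasurableSet
  simp only [translate_zero] at h0
  exact hn.trans h0.symm

lemma measure_stationary_preimage {Ω : Type*} [MeasurableSpace Ω] {P : Measure Ω}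
    {X : ℤ → Ω → E} (h : IsStationary X P) {s : Set E} (hs : MeasurableSet s) (n : ℤ) :
    P {ω | X n ω ∈ s} = P {ω | X 0 ω ∈ s} := by
  simpa using measure_translate_preimage h (measurable_pi_apply (0 : ℤ) hs) n

/-- An integrable functional of a stationary sequence grows sublinearly. -/
lemma ae_eventually_le_mul [IsProbabilityMeasure μ] (hT : MeasurePreserving (shift (E := E)) μ μ)
    {Y : (ℤ → E) → ℝ} (hm : Measurable Y) (hY : Integrable Y μ) (h0 : 0 ≤ Y) {ε : ℝ}
    (hε : 0 < ε) : ∀ᵐ u ∂μ, ∀ᶠ n : ℕ in atTop, Y (translate (-n) u) ≤ n * ε := by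
  let _ : MeasureSpace (ℤ → E) := ⟨μ⟩
  have hsum := tsum_prob_mem_Ioi_lt_top (X := fun u => Y u / ε)
    (show Integrable _ μ from hY.div_const ε) (fun u => div_nonneg (h0 u) hε.le)
  have hset : ∀ n : ℕ, μ {u | Y (translate (-n) u) / ε ∈ Set.Ioi (n : ℝ)}
      = μ {u | Y u / ε ∈ Set.Ioi (n : ℝ)} := fun n =>
    (measurePreserving_translate hT (-n)).measure_preimage
      ((hm.div_const ε) measurableSet_Ioi).nullMeasurableSet
  -- Borel–Cantelli: by stationarity these events have the probabilities of `Y / ε > n`, summable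
  -- because `Y` is integrable.
  have := ae_eventually_notMem (μ := μ) (s := fun n : ℕ =>
    {u | Y (translate (-n) u) / ε ∈ Set.Ioi (n : ℝ)}) (by simp_rw [hset]; exact hsum.ne)
  filter_upwards [this] with u hu
  filter_upwards [hu] with n hn
  simpa [div_le_iff₀ hε] using hn

end Translate

/-! ### Factors of stationary sequences -/

section Factor

variable {Ω E F : Type*} [MeasurableSpace Ω] [MeasurableSpace E] [MeasurableSpace F]
  {P : Measure Ω} {X : ℤ → Ω → E}

lemma IsStationaryErgodic.isStationary (h : IsStationaryErgodic X P) : IsStationary X P :=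
  ⟨h.1, h.2.toMeasurePreserving⟩

lemma IsStationary.measurable_path (h : IsStationary X P) : Measurable fun ω i => X i ω :=
  measurable_pi_lambda _ h.1

/-- Applying a measurable functional to the translates of a stationary and ergodic sequence
gives a stationary and ergodic sequence. -/
lemma IsStationaryErgodic.factor (h : IsStationaryErgodic X P) {G : (ℤ → E) → F}
    (hG : Measurable G) :
    IsStationaryErgodic (fun i ω => G (translate i fun j => X j ω)) P := by
  have hX := h.isStationary.measurable_path
  have hΨ : Measurable fun (u : ℤ → E) (i : ℤ) => G (translate i u) :=
    measurable_pi_lambda _ fun i => hG.comp (measurable_translate i)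
  refine ⟨fun i => hG.comp ((measurable_translate i).comp hX), ?_⟩
  have hshift : Measurable (shift (E := F)) := measurable_translate 1
  refine MeasurePreserving.ergodic_of_ergodic_semiconj
    (g := fun (u : ℤ → E) (i : ℤ) => G (translate i u)) ⟨hΨ, ?_⟩ h.2 hshift (fun u => ?_)
  · rw [Measure.map_map hΨ hX]; rfl
  · funext i
    simp only [← translate_one, translate_translate, translate_apply]

end Factor

/-! ### Random iterations -/

section Iteration

variable {E M : Type*}

/-- The state reached from `m` by applying `Φ (u 0), …, Φ (u (n - 1))` successively. -/
def iterState (Φ : E → M → M) (u : ℤ → E) : ℕ → M → M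
  | 0, m => m
  | n + 1, m => Φ (u n) (iterState Φ u n m)

/-- Splitting off the first map instead of the last compares iterations started at consecutive times
in the past. -/
lemma iterState_succ' (Φ : E → M → M) (u : ℤ → E) (n : ℕ) (m : M) :
    iterState Φ u (n + 1) m = iterState Φ (translate 1 u) n (Φ (u 0) m) := by
  induction n with
  | zero => simp [iterState]
  | succ n ih =>
    rw [iterState, ih, iterState]
    simp

lemma eq_iterState {Φ : E → M → M} {u : ℤ → E} {y : ℤ → M}
    (hy : ∀ i, y (i + 1) = Φ (u i) (y i)) (i : ℤ) (n : ℕ) :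
    y (i + n) = iterState Φ (translate i u) n (y i) := by
  induction n with
  | zero => simp [iterState]
  | succ n ih =>
    rw [iterState, ← ih, Nat.cast_succ, ← add_assoc, hy, translate_apply, add_comm (n : ℤ)]

lemma dist_iterState_le [PseudoMetricSpace M] {Φ : E → M → M} {g : E → ℝ} {u : ℤ → E}
    (hu : ∀ i a b, dist (Φ (u i) a) (Φ (u i) b) ≤ Real.exp (g (u i)) * dist a b)
    (n : ℕ) (a b : M) :
    dist (iterState Φ u n a) (iterState Φ u n b)
      ≤ Real.exp (∑ j ∈ Finset.range n, g (u j)) * dist a b := by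
  induction n with
  | zero => simp [iterState]
  | succ n ih =>
    refine (hu n _ _).trans ?_
    rw [Finset.sum_range_succ, add_comm, Real.exp_add, mul_assoc]
    exact mul_le_mul_of_nonneg_left ih (Real.exp_pos _).le

/-- A stationary and ergodic sequence `u` of driving variables and random maps `Φ (u i)` which are
contracting on the average: `exp (g (u i))` is a Lipschitz constant of `Φ (u i)`, with
`E g (u i) < 0`, and the maps move `m₀` by a distance with a logarithmic moment. -/
structure IsContractingOnAverage [MeasurableSpace E] [MetricSpace M] [MeasurableSpace M]
    (Φ : E → M → M) (g : E → ℝ) (m₀ : M) (μ : Measure (ℤ → E)) : Prop where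
  ergodic : Ergodic (shift (E := E)) μ
  measurable_map : Measurable (Function.uncurry Φ)
  continuous_map : ∀ e, Continuous (Φ e)
  measurable_rate : Measurable g
  integrable_rate : Integrable (fun u : ℤ → E => g (u 0)) μ
  integral_rate_neg : ∫ u : ℤ → E, g (u 0) ∂μ < 0
  dist_le : ∀ᵐ u : ℤ → E ∂μ, ∀ a b, dist (Φ (u 0) a) (Φ (u 0) b) ≤ Real.exp (g (u 0)) * dist a b
  integrable_posLog : Integrable (fun u : ℤ → E => Real.posLog (dist (Φ (u 0) m₀) m₀)) μ

namespace IsContractingOnAverage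

variable [MeasurableSpace E] [MetricSpace M] [MeasurableSpace M]
  {Φ : E → M → M} {g : E → ℝ} {m₀ : M} {μ : Measure (ℤ → E)}

lemma ae_dist_le (h : IsContractingOnAverage Φ g m₀ μ) :
    ∀ᵐ u : ℤ → E ∂μ, ∀ i a b, dist (Φ (u i) a) (Φ (u i) b) ≤ Real.exp (g (u i)) * dist a b := by
  rw [ae_all_iff]
  intro i
  simpa using (measurePreserving_translate h.ergodic.toMeasurePreserving i).quasiMeasurePreserving.ae
    h.dist_le

variable [IsProbabilityMeasure μ]

lemma exists_forward_rate (h : IsContractingOnAverage Φ g m₀ μ) :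
    ∃ ε > 0, ∀ᵐ u : ℤ → E ∂μ, ∃ C : ℝ, ∀ n : ℕ,
      ∑ j ∈ Finset.range n, g (u j) ≤ C - n * ε := by
  have hneg := h.integral_rate_neg
  refine ⟨-(∫ u : ℤ → E, g (u 0) ∂μ) / 2, by linarith, ?_⟩
  have := exists_birkhoffSum_le h.ergodic (h.measurable_rate.comp (measurable_pi_apply 0))
    h.integrable_rate (ε := -(∫ u : ℤ → E, g (u 0) ∂μ) / 2)
    (by simp only [Function.comp_apply]; linarith)
  simpa [birkhoffSum, ← translate_one, iterate_translate] using this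

lemma exists_backward_rate (h : IsContractingOnAverage Φ g m₀ μ) :
    ∃ ε > 0, ∀ᵐ u : ℤ → E ∂μ, ∃ C : ℝ, ∀ n : ℕ,
      ∑ j ∈ Finset.range n, g (translate (-n) u j) ≤ C - n * ε := by
  have hneg := h.integral_rate_neg
  refine ⟨-(∫ u : ℤ → E, g (u 0) ∂μ) / 2, by linarith, ?_⟩
  have := exists_birkhoffSum_le (ergodic_translate_neg_one h.ergodic)
    (h.measurable_rate.comp (measurable_pi_apply 0))
    h.integrable_rate (ε := -(∫ u : ℤ → E, g (u 0) ∂μ) / 2)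
    (by simp only [Function.comp_apply]; linarith)
  -- The Birkhoff sum of the inverse shift at `u` runs over the times `0, …, -(n - 1)`. Evaluating
  -- it at `translate (-1) u` gives `-1, …, -n`, the times wanted, in reverse order.
  have := (measurePreserving_translate h.ergodic.toMeasurePreserving
    (-1)).quasiMeasurePreserving.ae this
  filter_upwards [this] with u ⟨C, hC⟩
  refine ⟨C, fun n => ?_⟩
  have hn := hC n
  rw [birkhoffSum, ← Finset.sum_range_reflect] at hn
  convert hn using 1
  refine Finset.sum_congr rfl fun j hj => ?_
  have := Finset.mem_range.1 hj
  simp only [iterate_translate, translate_apply, Function.comp_apply]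
  congr 2
  omega

/-- The iterations started at times `-n` and `-(n + 1)` apply the same last `n` maps, to `m₀` and to
`Φ (u (-(n + 1))) m₀`. The backward rate `ε` beats the growth of the distance of these two points,
of rate at most `ε / 2`, so the increments are summable. -/
lemma ae_cauchySeq (h : IsContractingOnAverage Φ g m₀ μ)
    (hdist : Measurable fun u : ℤ → E => dist (Φ (u 0) m₀) m₀) :
    ∀ᵐ u : ℤ → E ∂μ, CauchySeq fun n : ℕ => iterState Φ (translate (-n) u) n m₀ := by
  obtain ⟨ε, hε, hback⟩ := h.exists_backward_rate
  have hpl := ae_eventually_le_mul h.ergodic.toMeasurePreserving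
    (Real.continuous_posLog.measurable.comp hdist) h.integrable_posLog (fun _ => Real.posLog_nonneg)
    (half_pos hε)
  filter_upwards [hback, hpl, h.ae_dist_le] with u ⟨C, hC⟩ hu hlip
  refine cauchySeq_of_summable_dist ?_
  have hgeo : Summable fun n : ℕ => Real.exp (C + ε / 2) * Real.exp (-(ε / 2)) ^ n :=
    (summable_geometric_of_lt_one (Real.exp_pos _).le
      (Real.exp_lt_one_iff.2 (by linarith))).mul_left _
  refine Summable.of_norm_bounded_eventually_nat hgeo ?_
  filter_upwards [(tendsto_add_atTop_nat 1).eventually hu] with n hn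
  rw [Real.norm_of_nonneg dist_nonneg, iterState_succ', dist_comm]
  have htr : translate 1 (translate (-((n + 1 : ℕ) : ℤ)) u) = translate (-(n : ℤ)) u := by
    rw [translate_translate]; congr 1; push_cast; ring
  rw [htr]
  refine (dist_iterState_le (g := g) (fun i a b => hlip _ a b) n _ _).trans ?_
  have hD : dist (Φ (translate (-((n + 1 : ℕ) : ℤ)) u 0) m₀) m₀
      ≤ Real.exp ((n + 1 : ℕ) * (ε / 2)) := by
    rcases (dist_nonneg (x := Φ (translate (-((n + 1 : ℕ) : ℤ)) u 0) m₀)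
      (y := m₀)).eq_or_lt with h0 | h0
    · rw [← h0]; exact (Real.exp_pos _).le
    · rw [← Real.log_le_iff_le_exp h0]
      exact (le_max_right _ _).trans hn
  calc _ ≤ Real.exp (C - n * ε) * Real.exp ((n + 1 : ℕ) * (ε / 2)) :=
        mul_le_mul (Real.exp_le_exp.2 (hC n)) hD dist_nonneg (Real.exp_pos _).le
    _ = _ := by
        rw [← Real.exp_add, ← Real.exp_nat_mul, ← Real.exp_add]
        congr 1; push_cast; ring

omit [IsProbabilityMeasure μ] in
lemma measurable_iterState (h : IsContractingOnAverage Φ g m₀ μ) (n : ℕ) (m : M) :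
    Measurable fun u : ℤ → E => iterState Φ u n m := by
  induction n with
  | zero => exact measurable_const
  | succ n ih => exact h.measurable_map.comp ((measurable_pi_apply (n : ℤ)).prodMk ih)

/-- The limit of the backward iterations is a stationary solution of the recursion. -/
theorem exists_stationary_solution [CompleteSpace M] [SecondCountableTopology M] [BorelSpace M]
    (h : IsContractingOnAverage Φ g m₀ μ) :
    ∃ F : (ℤ → E) → M, Measurable F ∧
      ∀ᵐ u ∂μ, ∀ i : ℤ, F (translate (i + 1) u) = Φ (u i) (F (translate i u)) := by
  have hdist : Measurable fun u : ℤ → E => dist (Φ (u 0) m₀) m₀ :=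
    (h.measurable_iterState 1 m₀).dist measurable_const
  obtain ⟨F, hF, hlim⟩ := measurable_limit_of_tendsto_metrizable_ae
    (f := fun (n : ℕ) u => iterState Φ (translate (-n) u) n m₀) (L := atTop)
    (fun n => ((h.measurable_iterState n m₀).comp (measurable_translate _)).aemeasurable)
    ((h.ae_cauchySeq hdist).mono fun u hu => cauchySeq_tendsto_of_complete hu)
  refine ⟨F, hF, ?_⟩
  have hall : ∀ᵐ u ∂μ, ∀ i : ℤ, Tendsto (fun n : ℕ =>
      iterState Φ (translate (-n) (translate i u)) n m₀) atTop (𝓝 (F (translate i u))) :=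
    ae_all_iff.2 fun i =>
      (measurePreserving_translate h.ergodic.toMeasurePreserving i).quasiMeasurePreserving.ae hlim
  filter_upwards [hall] with u hu i
  -- Applying `Φ (u i)` to the iteration of length `n` ending at time `i` gives the one of length `n
  -- + 1` ending at `i + 1`; both have the same starting time.
  have h1 := (hu (i + 1)).comp (tendsto_add_atTop_nat 1)
  have h2 := ((h.continuous_map (u i)).tendsto _).comp (hu i)
  refine tendsto_nhds_unique h1 (h2.congr fun n => ?_)
  simp only [Function.comp_apply, iterState, translate_translate, translate_apply]
  congr 2
  · push_cast; ring
  · congr 1; push_cast; ring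

end IsContractingOnAverage

end Iteration

/-! ### Uniqueness of stationary solutions -/

section Uniqueness

variable {Ω E M : Type*} [MeasurableSpace Ω] {P : Measure Ω}

lemma tendsto_measure_le_of_tendsto_ae [IsProbabilityMeasure P] {Y : ℕ → Ω → ℝ} (hm : ∀ n, Measurable (Y n))
    (h : ∀ᵐ ω ∂P, Tendsto (fun n => Y n ω) atTop (𝓝 0)) {ε : ℝ} (hε : 0 < ε) :
    Tendsto (fun n => P {ω | ε ≤ Y n ω}) atTop (𝓝 0) := by
  have := tendstoInMeasure_iff_norm.1
    (tendstoInMeasure_of_tendsto_ae (fun n => (hm n).aestronglyMeasurable) h) ε hε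
  refine tendsto_of_tendsto_of_tendsto_of_le_of_le tendsto_const_nhds this (fun _ => zero_le)
    fun n => measure_mono fun ω hω => ?_
  simp only [sub_zero, Set.mem_ofPred_eq] at hω ⊢
  exact hω.trans (le_abs_self _)

lemma ae_eq_of_forall_measure_le_dist_eq_zero [MetricSpace M] {y z : Ω → M}
    (h : ∀ ε > 0, P {ω | ε ≤ dist (y ω) (z ω)} = 0) : ∀ᵐ ω ∂P, y ω = z ω := by
  have : ∀ᵐ ω ∂P, ∀ n : ℕ, ¬ (1 / ((n : ℝ) + 1) ≤ dist (y ω) (z ω)) :=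
    ae_all_iff.2 fun n => by
      rw [ae_iff]; simpa using h _ Nat.one_div_pos_of_nat
  filter_upwards [this] with ω hω
  by_contra hne
  obtain ⟨n, hn⟩ := exists_nat_one_div_lt (dist_pos.2 hne)
  exact hω n hn.le

variable [MeasurableSpace E] [MetricSpace M] [MeasurableSpace M] [BorelSpace M]
  [SecondCountableTopology M] [IsProbabilityMeasure P]

/-- A sequence which is stationary jointly with the data and asymptotically equal to a stationary
functional of the data is equal to it. -/
lemma ae_eq_of_tendsto_dist {X : ℤ → Ω → E} {F : (ℤ → E) → M} (hF : Measurable F)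
    {y : ℤ → Ω → M} (hy : IsStationary (fun i ω => (X i ω, y i ω)) P)
    (hlim : ∀ᵐ ω ∂P, Tendsto (fun n : ℕ =>
      dist (y n ω) (F (translate n fun j => X j ω))) atTop (𝓝 0)) :
    ∀ᵐ ω ∂P, ∀ i, y i ω = F (translate i fun j => X j ω) := by
  rw [ae_all_iff]
  intro i
  -- The distance at time `n` is this functional of the translated joint sequence, so its law is the
  -- same for all `n`.
  let H : (ℤ → E × M) → ℝ := fun z => dist (z 0).2 (F fun j => (z j).1)
  have hH : Measurable H := by
    refine (measurable_snd.comp (measurable_pi_apply 0)).dist (hF.comp ?_)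
    exact measurable_pi_lambda _ fun j => measurable_fst.comp (measurable_pi_apply j)
  have hHeq : ∀ (n : ℤ) (ω : Ω), H (translate n fun j => (X j ω, y j ω))
      = dist (y n ω) (F (translate n fun j => X j ω)) := by
    intro n ω
    simp only [H, translate_apply, zero_add]
    rfl
  refine ae_eq_of_forall_measure_le_dist_eq_zero fun ε hε => ?_
  have hconst : ∀ n : ℤ, P {ω | ε ≤ dist (y n ω) (F (translate n fun j => X j ω))}
      = P {ω | (fun j => (X j ω, y j ω)) ∈ H ⁻¹' Set.Ici ε} := by
    intro n
    rw [← measure_translate_preimage hy (hH measurableSet_Ici) n]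
    simp only [Set.mem_preimage, hHeq, Set.mem_Ici]
  have hmeas : ∀ n : ℕ, Measurable fun ω => dist (y n ω) (F (translate n fun j => X j ω)) := by
    intro n
    simp only [← hHeq]
    exact hH.comp ((measurable_translate _).comp hy.measurable_path)
  have := tendsto_measure_le_of_tendsto_ae hmeas hlim hε
  simp only [hconst] at this
  rw [hconst]
  exact tendsto_nhds_unique tendsto_const_nhds this

lemma tendsto_measure_le_dist {y : Ω → M} (hy : Measurable y) (m : M) :
    Tendsto (fun K : ℕ => P {ω | (K : ℝ) + 1 ≤ dist (y ω) m}) atTop (𝓝 0) := by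
  have := tendsto_measure_le_of_tendsto_ae (P := P)
    (Y := fun (K : ℕ) ω => dist (y ω) m / ((K : ℝ) + 1))
    (fun K => (hy.dist measurable_const).div_const _)
    (ae_of_all _ fun ω => by
      simpa [div_eq_mul_one_div (dist (y ω) m)] using
        (tendsto_one_div_add_atTop_nhds_zero_nat (𝕜 := ℝ)).const_mul (dist (y ω) m)) one_pos
  refine this.congr fun K => ?_
  simp_rw [one_le_div (Nat.cast_add_one_pos (α := ℝ) K)]

/-- Two stationary solutions of a recursion which is contracting on the average coincide. -/
lemma IsContractingOnAverage.ae_eq_of_solutions {X : ℤ → Ω → E} {Φ : E → M → M} {g : E → ℝ}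
    {m₀ : M} (hX : ∀ i, Measurable (X i))
    (h : IsContractingOnAverage Φ g m₀ (P.map fun ω i => X i ω))
    {y z : ℤ → Ω → M} (hy : IsStationary y P) (hz : IsStationary z P)
    (hys : ∀ᵐ ω ∂P, ∀ i, y (i + 1) ω = Φ (X i ω) (y i ω))
    (hzs : ∀ᵐ ω ∂P, ∀ i, z (i + 1) ω = Φ (X i ω) (z i ω)) :
    ∀ᵐ ω ∂P, ∀ i, y i ω = z i ω := by
  have hXp : Measurable fun ω i => X i ω := measurable_pi_lambda _ hX
  have : IsProbabilityMeasure (P.map fun ω i => X i ω) :=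
    Measure.isProbabilityMeasure_map hXp.aemeasurable
  rw [ae_all_iff]
  intro i
  refine ae_eq_of_forall_measure_le_dist_eq_zero fun η hη => ?_
  -- A Lipschitz constant of the composed maps from time `i - n` to time `i`.
  let R : ℕ → Ω → ℝ := fun n ω =>
    Real.exp (∑ j ∈ Finset.range n, g (translate (-n) (translate i fun k => X k ω) j))
  have hR : ∀ n, Measurable (R n) := fun n =>
    Real.measurable_exp.comp (Finset.measurable_sum _ fun j _ => h.measurable_rate.comp (hX _))
  have hRlim : ∀ᵐ ω ∂P, Tendsto (fun n => R n ω) atTop (𝓝 0) := by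
    obtain ⟨ε, hε, hback⟩ := h.exists_backward_rate
    have h1 := (measurePreserving_translate h.ergodic.toMeasurePreserving
      i).quasiMeasurePreserving.ae hback
    filter_upwards [ae_of_ae_map hXp.aemeasurable h1] with ω ⟨C, hC⟩
    refine Real.tendsto_exp_atBot.comp (tendsto_atBot_mono hC ?_)
    exact tendsto_atBot_add_const_left _ C (tendsto_neg_atTop_atBot.comp
      (tendsto_natCast_atTop_atTop.atTop_mul_const hε))
  have hle : ∀ᵐ ω ∂P, ∀ n : ℕ, dist (y i ω) (z i ω)
      ≤ R n ω * (dist (y (i - n) ω) m₀ + dist (z (i - n) ω) m₀) := by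
    filter_upwards [hys, hzs, ae_of_ae_map hXp.aemeasurable h.ae_dist_le] with ω h1 h2 h3 n
    have e1 := eq_iterState (Φ := Φ) (u := fun k => X k ω) (y := fun k => y k ω) h1 (i - n) n
    have e2 := eq_iterState (Φ := Φ) (u := fun k => X k ω) (y := fun k => z k ω) h2 (i - n) n
    simp only [sub_add_cancel] at e1 e2
    rw [e1, e2]
    refine (dist_iterState_le (g := g) (fun _ a b => h3 _ a b) n _ _).trans ?_
    have : R n ω = Real.exp (∑ j ∈ Finset.range n,
        g (translate (i - n) (fun k => X k ω) j)) := by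
      simp only [R, translate_translate]
      rw [neg_add_eq_sub]
    rw [this]
    exact mul_le_mul_of_nonneg_left (dist_triangle_right _ _ _) (Real.exp_pos _).le
  -- If both states at time `i - n` lie within `K + 1` of `m₀`, a distance of at least `η` at time
  -- `i` forces `R n ≥ η / (2 (K + 1))`. The union bound uses only the separate stationarity of `y`
  -- and `z`. Then `n → ∞`, and afterwards `K → ∞`.
  have hsplit : ∀ K n : ℕ, P {ω | η ≤ dist (y i ω) (z i ω)}
      ≤ P {ω | η / (2 * ((K : ℝ) + 1)) ≤ R n ω} + (P {ω | (K : ℝ) + 1 ≤ dist (y 0 ω) m₀}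
        + P {ω | (K : ℝ) + 1 ≤ dist (z 0 ω) m₀}) := by
    intro K n
    have hcl : MeasurableSet {m : M | (K : ℝ) + 1 ≤ dist m m₀} :=
      (isClosed_le continuous_const (continuous_id.dist continuous_const)).measurableSet
    have ey := measure_stationary_preimage hy hcl (i - n)
    have ez := measure_stationary_preimage hz hcl (i - n)
    simp only [Set.mem_ofPred_eq] at ey ez
    rw [← ey, ← ez]
    refine le_trans (measure_mono_ae ?_)
      ((measure_union_le _ _).trans (add_le_add_right (measure_union_le _ _) _))
    filter_upwards [hle] with ω hω hηω
    by_contra hcon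
    have hcon' : ¬ (η / (2 * ((K : ℝ) + 1)) ≤ R n ω ∨ (K : ℝ) + 1 ≤ dist (y (i - n) ω) m₀ ∨
      (K : ℝ) + 1 ≤ dist (z (i - n) ω) m₀) := hcon
    push Not at hcon'
    obtain ⟨c1, c2, c3⟩ := hcon'
    have hK : (0 : ℝ) < 2 * ((K : ℝ) + 1) := by positivity
    rw [lt_div_iff₀ hK] at c1
    have hηω' : η ≤ dist (y i ω) (z i ω) := hηω
    have h4 : R n ω * (dist (y (i - n) ω) m₀ + dist (z (i - n) ω) m₀)
        ≤ R n ω * (2 * ((K : ℝ) + 1)) :=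
      mul_le_mul_of_nonneg_left (by linarith) (Real.exp_pos _).le
    linarith [hω n]
  have hK : ∀ K : ℕ, P {ω | η ≤ dist (y i ω) (z i ω)}
      ≤ P {ω | (K : ℝ) + 1 ≤ dist (y 0 ω) m₀} + P {ω | (K : ℝ) + 1 ≤ dist (z 0 ω) m₀} := by
    intro K
    have h1 := (tendsto_measure_le_of_tendsto_ae hR hRlim
      (show 0 < η / (2 * ((K : ℝ) + 1)) by positivity)).add_const
      (P {ω | (K : ℝ) + 1 ≤ dist (y 0 ω) m₀} + P {ω | (K : ℝ) + 1 ≤ dist (z 0 ω) m₀})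
    rw [zero_add] at h1
    exact ge_of_tendsto' h1 (hsplit K)
  have h2 := (tendsto_measure_le_dist (P := P) (hy.1 0) m₀).add
    (tendsto_measure_le_dist (P := P) (hz.1 0) m₀)
  rw [add_zero] at h2
  exact le_antisymm (ge_of_tendsto' h2 hK) zero_le

end Uniqueness

/-! ### The score -/

section Score

/-- The exponent is `log (α m + 1) / α`, that is, `m` times the difference quotient of `log` at `1`.
`dslope` fills in the derivative at `α = 0`, which gives joint continuity through the Poisson case.
-/
lemma invZeroProb_eq_exp {α m : ℝ} (hα : 0 ≤ α) (hm : 0 < m) :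
    invZeroProb α m = Real.exp (m * dslope Real.log 1 (α * m + 1)) := by
  unfold invZeroProb
  split_ifs with h
  · simp [h]
  · have hα' : 0 < α := lt_of_le_of_ne hα (Ne.symm h)
    have hpos : 0 < α * m := mul_pos hα' hm
    rw [dslope_of_ne _ (by linarith [hpos] : α * m + 1 ≠ 1), slope_def_field, Real.log_one,
      Real.rpow_def_of_pos (by linarith)]
    congr 1
    field_simp
    rw [add_sub_cancel_right, mul_comm, sub_zero]

lemma one_le_invZeroProb {α m : ℝ} (hα : 0 ≤ α) (hm : 0 < m) : 1 ≤ invZeroProb α m := by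
  unfold invZeroProb
  split_ifs with h
  · exact Real.one_le_exp hm.le
  · exact Real.one_le_rpow (by nlinarith) (inv_nonneg.2 hα)

lemma differentiableAt_invZeroProb {α m : ℝ} (hα : 0 ≤ α) (hm : 0 < m) :
    DifferentiableAt ℝ (invZeroProb α) m := by
  unfold invZeroProb
  split_ifs with h
  · exact Real.differentiableAt_exp
  · have : α * m + 1 ≠ 0 := by nlinarith
    exact DifferentiableAt.rpow_const (by fun_prop) (Or.inl this)

variable {θ : Param}

lemma one_le_dispersion_denom (hθ : Admissible θ) (f : ℝ) :
    1 ≤ dispersion θ * Real.exp f + 1 := by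
  linarith [mul_nonneg hθ.1 (Real.exp_pos f).le]

lemma one_le_inflation_denom (hθ : Admissible θ) (f : ℝ) :
    1 ≤ 1 + inflation θ * invZeroProb (dispersion θ) (Real.exp f) - inflation θ := by
  nlinarith [hθ.2.1, one_le_invZeroProb hθ.1 (Real.exp_pos f)]

lemma one_le_score_zero_denom (hθ : Admissible θ) (f : ℝ) :
    1 ≤ (dispersion θ * Real.exp f + 1) *
      (1 + inflation θ * invZeroProb (dispersion θ) (Real.exp f) - inflation θ) :=
  one_le_mul_of_one_le_of_one_le (one_le_dispersion_denom hθ f) (one_le_inflation_denom hθ f)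

lemma differentiable_score (k : ℕ) (hθ : Admissible θ) :
    Differentiable ℝ fun u => score k u θ := by
  intro f
  unfold score
  split_ifs with hk
  · have h := (differentiableAt_invZeroProb hθ.1 (Real.exp_pos f)).comp f
      (Real.differentiableAt_exp (x := f))
    have hne := (zero_lt_one.trans_le (one_le_score_zero_denom hθ f)).ne'
    refine DifferentiableAt.div (by fun_prop) (DifferentiableAt.mul (by fun_prop) ?_) hne
    exact ((h.const_mul _).const_add _).sub_const _
  · have hne := (zero_lt_one.trans_le (one_le_dispersion_denom hθ f)).ne'
    exact DifferentiableAt.div (by fun_prop) (by fun_prop) hne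

lemma continuous_score {Θ : Set Param} (hadm : ∀ θ ∈ Θ, Admissible θ) (k : ℕ) :
    Continuous fun p : ℝ × Θ => score k p.1 p.2 := by
  have hd : Continuous fun p : ℝ × Θ => dispersion p.2 := 
    (continuous_apply 0).comp (continuous_subtype_val.comp continuous_snd)
  have hi : Continuous fun p : ℝ × Θ => inflation p.2 := 
    (continuous_apply 1).comp (continuous_subtype_val.comp continuous_snd)
  have he : Continuous fun p : ℝ × Θ => Real.exp p.1 := by fun_prop
  have hz : Continuous fun p : ℝ × Θ => invZeroProb (dispersion p.2) (Real.exp p.1) := by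
    have h1 : ContinuousOn (dslope Real.log 1) (Set.Ioi 0) :=
      (continuousOn_dslope (Ioi_mem_nhds one_pos)).2
        ⟨Real.continuousOn_log.mono fun t (ht : 0 < t) => ht.ne',
          Real.differentiableAt_log one_ne_zero⟩
    have h2 : Continuous fun p : ℝ × Θ =>
        dslope Real.log 1 (dispersion p.2 * Real.exp p.1 + 1) :=
      h1.comp_continuous ((hd.mul he).add_const 1) fun p =>
        zero_lt_one.trans_le (one_le_dispersion_denom (hadm _ p.2.2) p.1)
    refine (Real.continuous_exp.comp (he.mul h2)).congr fun p => ?_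
    exact (invZeroProb_eq_exp (hadm _ p.2.2).1 (Real.exp_pos p.1)).symm
  unfold score
  split_ifs with hk
  · exact ((hi.sub continuous_const).mul he).div
      (((hd.mul he).add_const 1).mul ((continuous_const.add (hi.mul hz)).sub hi)) fun p =>
        (zero_lt_one.trans_le (one_le_score_zero_denom (hadm _ p.2.2) p.1)).ne'
  · exact (continuous_const.sub he).div ((hd.mul he).add_const 1) fun p =>
      (zero_lt_one.trans_le (one_le_dispersion_denom (hadm _ p.2.2) p.1)).ne'

lemma score_zero_neg (hθ : Admissible θ) (f : ℝ) : score 0 f θ < 0 := by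
  rw [score, if_pos rfl]
  exact div_neg_of_neg_of_pos (mul_neg_of_neg_of_pos (by linarith [hθ.2.2]) (Real.exp_pos f))
    (zero_lt_one.trans_le (one_le_score_zero_denom hθ f))

lemma abs_score_zero_le (hθ : Admissible θ) (f : ℝ) : |score 0 f θ| ≤ Real.exp f := by
  rw [score, if_pos rfl, abs_div, abs_mul, Real.abs_exp]
  have h1 := one_le_score_zero_denom hθ f
  have h2 : |inflation θ - 1| ≤ 1 := abs_le.2 ⟨by linarith [hθ.2.1], by linarith [hθ.2.2]⟩
  rw [abs_of_pos (zero_lt_one.trans_le h1)]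
  refine (div_le_self (by positivity) h1).trans ?_
  exact mul_le_of_le_one_left (Real.exp_pos f).le h2

lemma abs_score_le_of_nonpos (k : ℕ) (hθ : Admissible θ) {f : ℝ} (hf : f ≤ 0) :
    |score k f θ| ≤ k + 1 := by
  have he : Real.exp f ≤ 1 := Real.exp_le_one_iff.2 hf
  rcases Nat.eq_zero_or_pos k with rfl | hk
  · exact (abs_score_zero_le hθ f).trans (by simpa using he)
  · rw [score, if_neg hk.ne', abs_div]
    have h1 := one_le_dispersion_denom hθ f
    rw [abs_of_pos (zero_lt_one.trans_le h1)]
    refine (div_le_self (abs_nonneg _) h1).trans ?_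
    have := Real.exp_pos f
    have hk0 : (0 : ℝ) ≤ k := k.cast_nonneg
    exact abs_le.2 ⟨by linarith, by linarith⟩

/-- The exact difference carries the factor `k α + 1 ≥ 1`; dropping it leaves a bound independent of
`k`. -/
lemma le_abs_score_sub {k : ℕ} (hk : k ≠ 0) (hθ : Admissible θ) :
    (Real.exp 1 - 1) / ((dispersion θ * Real.exp 1 + 1) * (dispersion θ + 1))
      ≤ |score k 1 θ - score k 0 θ| := by
  have h1 : 0 < dispersion θ * Real.exp 1 + 1 :=
    zero_lt_one.trans_le (one_le_dispersion_denom hθ 1)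
  have h2 : 0 < dispersion θ + 1 := by linarith [hθ.1]
  have h3 : 0 ≤ Real.exp 1 - 1 := by linarith [Real.add_one_le_exp 1]
  have key : score k 1 θ - score k 0 θ = -((Real.exp 1 - 1) * (k * dispersion θ + 1) /
      ((dispersion θ * Real.exp 1 + 1) * (dispersion θ + 1))) := by
    simp only [score, if_neg hk, Real.exp_zero, mul_one]
    rw [div_sub_div _ _ h1.ne' h2.ne', ← neg_div]
    congr 1
    ring
  have h4 : 0 ≤ (k : ℝ) * dispersion θ := mul_nonneg k.cast_nonneg hθ.1
  rw [key, abs_neg]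
  refine le_trans ?_ (le_abs_self _)
  gcongr
  nlinarith

/-! ### Lipschitz constants of the update -/

/-- `sup_f sup_θ |a ∂s(k, f, θ)/∂f + b|`, as an element of `[0, ∞]`. -/
noncomputable def contraction (Θ : Set Param) (k : ℕ) : ℝ≥0∞ :=
  ⨆ f : ℝ, ⨆ θ : Θ, ‖scoreCoef θ * deriv (fun u : ℝ => score k u θ) f + autoreg θ‖ₑ

lemma abs_update_sub_le {Θ : Set Param} (hadm : ∀ θ ∈ Θ, Admissible θ) {k : ℕ} {K : ℝ}
    (hK0 : 0 ≤ K) (hK : contraction Θ k ≤ ENNReal.ofReal K) {θ : Param} (hθ : θ ∈ Θ) (u v : ℝ) :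
    |update k u θ - update k v θ| ≤ K * |u - v| := by
  have hs := differentiable_score k (hadm θ hθ)
  have hder : ∀ f, HasDerivAt (fun u => update k u θ)
      (autoreg θ + scoreCoef θ * deriv (fun u : ℝ => score k u θ) f) f := by
    intro f
    have h1 := (((hasDerivAt_id f).const_mul (autoreg θ)).const_add (const θ)).add
      ((hs f).hasDerivAt.const_mul (scoreCoef θ))
    rw [mul_one] at h1
    exact h1
  have := Convex.norm_image_sub_le_of_norm_deriv_le (𝕜 := ℝ) (C := K) (x := v) (y := u)
    (f := fun u => update k u θ) (s := Set.univ)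
    (fun f _ => (hder f).differentiableAt) (fun f _ => ?_) convex_univ trivial trivial
  · simpa [Real.norm_eq_abs] using this
  · have h1 : ‖scoreCoef θ * deriv (fun u : ℝ => score k u θ) f + autoreg θ‖ₑ
        ≤ ENNReal.ofReal K :=
      le_trans (le_iSup₂_of_le (f := fun (f : ℝ) (θ : Θ) =>
        ‖scoreCoef θ * deriv (fun u : ℝ => score k u θ) f + autoreg θ‖ₑ) f ⟨θ, hθ⟩ le_rfl) hK
    rw [(hder f).deriv, add_comm]
    rwa [← ofReal_norm, ENNReal.ofReal_le_ofReal_iff hK0] at h1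

/-- The score is bounded for `f ≤ 0`, so the update has asymptotic slope `b` as `f → -∞`. -/
lemma abs_autoreg_le {k : ℕ} (hθ : Admissible θ) {K : ℝ}
    (hK : ∀ u v, |update k u θ - update k v θ| ≤ K * |u - v|) : |autoreg θ| ≤ K := by
  by_contra! hlt
  have hbd : ∀ n : ℕ, n * (|autoreg θ| - K) ≤ |scoreCoef θ| * (2 * (k + 1)) := by
    intro n
    have h1 := hK (-n) 0
    have hn : (0 : ℝ) ≤ n := n.cast_nonneg
    have h2 := abs_score_le_of_nonpos k hθ (neg_nonpos.2 hn)
    have h3 := abs_score_le_of_nonpos k hθ le_rfl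
    have h4 : |score k (-n) θ - score k 0 θ| ≤ 2 * (k + 1) :=
      (abs_sub _ _).trans (by linarith)
    have h5 : autoreg θ * n = -(update k (-n) θ - update k 0 θ)
        + scoreCoef θ * (score k (-n) θ - score k 0 θ) := by
      simp only [update]; ring
    have h6 : |autoreg θ| * n ≤ K * n + |scoreCoef θ| * (2 * (k + 1)) := by
      calc |autoreg θ| * n = |autoreg θ * n| := by rw [abs_mul, abs_of_nonneg hn]
        _ ≤ |update k (-n) θ - update k 0 θ| + |scoreCoef θ * (score k (-n) θ - score k 0 θ)| := by
            rw [h5, ← abs_neg (update k (-n) θ - update k 0 θ)]; exact abs_add_le _ _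
        _ ≤ _ := by
            rw [abs_mul]
            simp only [sub_zero, abs_neg, abs_of_nonneg hn] at h1
            exact add_le_add h1 (mul_le_mul_of_nonneg_left h4 (abs_nonneg _))
    linarith
  obtain ⟨n, hn⟩ := exists_nat_gt (|scoreCoef θ| * (2 * (k + 1)) / (|autoreg θ| - K))
  rw [div_lt_iff₀ (sub_pos.2 hlt)] at hn
  exact absurd (hbd n) (not_le.2 hn)

/-- For `b ≠ 0` the slope at `-∞` serves. For `b = 0` the score itself is not constant, by an amount
that does not depend on `k ≥ 1`; `k = 0` is treated apart. -/
lemma exists_pos_le_lipschitz (hθ : Admissible θ) (hne : ¬ (autoreg θ = 0 ∧ scoreCoef θ = 0)) :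
    ∃ δ > 0, ∀ (k : ℕ) (K : ℝ), (∀ u v, |update k u θ - update k v θ| ≤ K * |u - v|) →
      δ ≤ K := by
  by_cases hb : autoreg θ = 0
  swap
  · exact ⟨|autoreg θ|, abs_pos.2 hb, fun k K hK => abs_autoreg_le hθ hK⟩
  have ha : 0 < |scoreCoef θ| := abs_pos.2 fun h => hne ⟨hb, h⟩
  have hup : ∀ k u v, |update k u θ - update k v θ|
      = |scoreCoef θ| * |score k u θ - score k v θ| := by
    intro k u v
    rw [← abs_mul]; congr 1; simp only [update, hb]; ring
  have hd : 0 < (Real.exp 1 - 1) / ((dispersion θ * Real.exp 1 + 1) * (dispersion θ + 1)) := by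
    have h1 : 0 < dispersion θ * Real.exp 1 + 1 :=
      zero_lt_one.trans_le (one_le_dispersion_denom hθ 1)
    have h2 : 0 < dispersion θ + 1 := by linarith [hθ.1]
    have h3 : 0 < Real.exp 1 - 1 := by linarith [Real.add_one_lt_exp one_ne_zero]
    positivity
  -- Since `|score 0 w θ| ≤ exp w`, the choice `exp w = σ / 2` makes the score at `w` at most half
  -- as large as at `0`. The denominator `|w| + 1` below spares checking `w ≠ 0`.
  set σ := -score 0 0 θ with hσ
  have hσ0 : 0 < σ := neg_pos.2 (score_zero_neg hθ 0)
  set w := Real.log (σ / 2)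
  have hw : σ / 2 ≤ |score 0 w θ - score 0 0 θ| := by
    have h1 := abs_score_zero_le hθ w
    rw [Real.exp_log (half_pos hσ0)] at h1
    have := (abs_le.1 h1).1
    exact le_trans (by linarith) (le_abs_self _)
  have hw1 : 0 < |w| + 1 := by positivity
  refine ⟨min (|scoreCoef θ| * ((Real.exp 1 - 1) /
    ((dispersion θ * Real.exp 1 + 1) * (dispersion θ + 1))))
    (|scoreCoef θ| * (σ / 2) / (|w| + 1)), lt_min (by positivity) (by positivity), ?_⟩
  intro k K hK
  rcases eq_or_ne k 0 with rfl | hk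
  · refine (min_le_right _ _).trans ?_
    have h1 := hK w 0
    have hK0 : 0 ≤ K := (abs_nonneg _).trans (abs_autoreg_le hθ hK)
    rw [hup, sub_zero] at h1
    rw [div_le_iff₀ hw1]
    have h2 := mul_le_mul_of_nonneg_left hw ha.le
    linarith
  · refine (min_le_left _ _).trans ?_
    have h1 := hK 1 0
    rw [hup] at h1
    simp only [sub_zero, abs_one, mul_one] at h1
    exact (mul_le_mul_of_nonneg_left (le_abs_score_sub hk hθ) ha.le).trans h1

lemma exists_pos_le_contraction {Θ : Set Param} (hadm : ∀ θ ∈ Θ, Admissible θ)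
    (hθ : θ ∈ Θ) (hne : ¬ (autoreg θ = 0 ∧ scoreCoef θ = 0)) :
    ∃ δ : ℝ, 0 < δ ∧ ∀ k, ENNReal.ofReal δ ≤ contraction Θ k := by
  obtain ⟨δ, hδ, h⟩ := exists_pos_le_lipschitz (hadm θ hθ) hne
  refine ⟨δ, hδ, fun k => ?_⟩
  rcases eq_or_ne (contraction Θ k) ⊤ with htop | htop
  · simp [htop]
  · rw [← ENNReal.ofReal_toReal htop]
    exact ENNReal.ofReal_le_ofReal (h k _ fun u v =>
      abs_update_sub_le hadm ENNReal.toReal_nonneg (ENNReal.ofReal_toReal htop).ge hθ u v)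

end Score

/-! ### Logarithmic moments -/

section Moments

variable {Ω : Type*} [MeasurableSpace Ω]

lemma logPlus_ofReal (r : ℝ) (hr : 0 ≤ r) :
    logPlus (ENNReal.ofReal r) = ENNReal.ofReal (Real.posLog r) := by
  rcases hr.eq_or_lt with rfl | hr
  · simp [logPlus]
  · rw [logPlus, ENNReal.log_ofReal_of_pos hr, Real.posLog]
    rw [EReal.toENNReal_of_ne_top (EReal.coe_ne_top _), EReal.toReal_coe]
    rcases le_total 0 (Real.log r) with h | h
    · rw [max_eq_right h]
    · rw [max_eq_left h, ENNReal.ofReal_of_nonpos h, ENNReal.ofReal_zero]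

/-- The lower bound `d` makes the negative part integrable, and an expectation other than `⊤` does
the same for the positive part. -/
lemma extExpectation_eq_integral {ν : Measure Ω} [IsFiniteMeasure ν] {y : Ω → ℕ}
    (hy : Measurable y) {l : ℕ → EReal} {d : ℝ} (hd : ∀ k, (d : EReal) ≤ l k)
    (hne : extExpectation ν (fun ω => l (y ω)) ≠ ⊤) :
    (∀ᵐ ω ∂ν, l (y ω) ≠ ⊤) ∧ Integrable (fun ω => (l (y ω)).toReal) ν ∧
      extExpectation ν (fun ω => l (y ω)) = ((∫ ω, (l (y ω)).toReal ∂ν : ℝ) : EReal) := by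
  have hmeas : ∀ {β : Type} [MeasurableSpace β] (φ : ℕ → β), Measurable fun ω => φ (y ω) :=
    fun φ => (measurable_of_countable φ).comp hy
  have hI : ∫⁻ ω, (l (y ω)).toENNReal ∂ν ≠ ⊤ := by
    intro h
    exact hne (by rw [extExpectation, if_pos h])
  have htop : ∀ᵐ ω ∂ν, l (y ω) ≠ ⊤ := by
    filter_upwards [ae_lt_top (hmeas fun k => (l k).toENNReal) hI] with ω hω
    exact EReal.toENNReal_ne_top_iff.1 hω.ne
  have hcoe : ∀ᵐ ω ∂ν, l (y ω) = ((l (y ω)).toReal : EReal) := by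
    filter_upwards [htop] with ω hω
    exact (EReal.coe_toReal hω ((EReal.bot_lt_coe d).trans_le (hd _)).ne').symm
  have hpos : ∫⁻ ω, (l (y ω)).toENNReal ∂ν = ∫⁻ ω, ENNReal.ofReal (l (y ω)).toReal ∂ν :=
    lintegral_congr_ae (htop.mono fun ω hω => EReal.toENNReal_of_ne_top hω)
  have hneg : ∫⁻ ω, (-l (y ω)).toENNReal ∂ν = ∫⁻ ω, ENNReal.ofReal (-(l (y ω)).toReal) ∂ν := by
    refine lintegral_congr_ae (hcoe.mono fun ω hω => ?_)
    simp only
    rw [hω, ← EReal.coe_neg, EReal.toENNReal_of_ne_top (EReal.coe_ne_top _), EReal.toReal_coe,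
      EReal.toReal_coe]
  have hge : ∀ᵐ ω ∂ν, d ≤ (l (y ω)).toReal := by
    filter_upwards [hcoe] with ω hω
    have := hd (y ω)
    rw [hω] at this
    exact EReal.coe_le_coe_iff.1 this
  have hnegtop : ∫⁻ ω, ENNReal.ofReal (-(l (y ω)).toReal) ∂ν ≠ ⊤ := by
    refine ne_top_of_le_ne_top ?_ (lintegral_mono_ae (g := fun _ => ENNReal.ofReal (-d))
      (hge.mono fun ω hω => ENNReal.ofReal_le_ofReal (neg_le_neg hω)))
    rw [lintegral_const]
    exact ENNReal.mul_ne_top ENNReal.ofReal_ne_top (measure_ne_top _ _)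
  have hint : Integrable (fun ω => (l (y ω)).toReal) ν := by
    refine ⟨(hmeas fun k => (l k).toReal).aestronglyMeasurable, ?_⟩
    rw [hasFiniteIntegral_iff_norm]
    refine lt_of_le_of_lt (lintegral_mono (g := fun ω => ENNReal.ofReal (l (y ω)).toReal
      + ENNReal.ofReal (-(l (y ω)).toReal)) fun ω => ?_) ?_
    · rw [Real.norm_eq_abs]
      rcases abs_cases (l (y ω)).toReal with ⟨h, _⟩ | ⟨h, _⟩ <;> rw [h] <;> simp
    · rw [lintegral_add_left (hmeas fun k => ENNReal.ofReal (l k).toReal), ← hpos]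
      exact ENNReal.add_lt_top.2 ⟨hI.lt_top, hnegtop.lt_top⟩
  refine ⟨htop, hint, ?_⟩
  rw [extExpectation, if_neg hI, hneg, hpos,
    integral_eq_lintegral_pos_part_sub_lintegral_neg_part hint, EReal.coe_sub,
    EReal.coe_ennreal_toReal (hpos ▸ hI), EReal.coe_ennreal_toReal hnegtop]

lemma restrict_eq_smul_cond (P : Measure Ω) [IsFiniteMeasure P] {s : Set Ω} (hs : P s ≠ 0) :
    P.restrict s = P s • P[|s] := by
  rw [ProbabilityTheory.cond, smul_smul, ENNReal.mul_inv_cancel hs (measure_ne_top _ _), one_smul]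

variable {P : Measure Ω} [IsProbabilityMeasure P] {y : Ω → ℕ}

lemma ae_of_cond_pos (hy : Measurable y) {p : ℕ → Prop} (h0 : P {ω | y ω = 0} ≠ 0 → p 0)
    (h1 : P {ω | 0 < y ω} ≠ 0 → ∀ᵐ ω ∂(P[|{ω | 0 < y ω}]), p (y ω)) : ∀ᵐ ω ∂P, p (y ω) := by
  have hs : MeasurableSet {ω | 0 < y ω} := hy measurableSet_Ioi
  have e1 : ∀ᵐ ω ∂P, 0 < y ω → p (y ω) := by
    by_cases hp : P {ω | 0 < y ω} = 0
    · have : ∀ᵐ ω ∂P, ¬ 0 < y ω := measure_eq_zero_iff_ae_notMem.1 hp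
      exact this.mono fun ω hω h => absurd h hω
    · refine (ae_restrict_iff' hs).1 ?_
      rw [restrict_eq_smul_cond P hp]
      exact Measure.ae_smul_measure (h1 hp) _
  have e0 : ∀ᵐ ω ∂P, y ω = 0 → p (y ω) := by
    by_cases hq : P {ω | y ω = 0} = 0
    · have : ∀ᵐ ω ∂P, ¬ y ω = 0 := measure_eq_zero_iff_ae_notMem.1 hq
      exact this.mono fun ω hω h => absurd h hω
    · exact ae_of_all _ fun ω hω => by rw [hω]; exact h0 hq
  filter_upwards [e0, e1] with ω a0 a1
  rcases Nat.eq_zero_or_pos (y ω) with h | h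
  exacts [a0 h, a1 h]

lemma lintegral_lt_top_of_cond_pos (hy : Measurable y) {w : ℕ → ℝ≥0∞} (h0 : w 0 < ⊤)
    (h1 : ∫⁻ ω, w (y ω) ∂(P[|{ω | 0 < y ω}]) < ⊤) : ∫⁻ ω, w (y ω) ∂P < ⊤ := by
  have hs : MeasurableSet {ω | 0 < y ω} := hy measurableSet_Ioi
  rw [← lintegral_add_compl _ hs]
  refine ENNReal.add_lt_top.2 ⟨?_, ?_⟩
  · by_cases hp : P {ω | 0 < y ω} = 0
    · rw [Measure.restrict_eq_zero.2 hp, lintegral_zero_measure]; exact ENNReal.zero_lt_top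
    · rw [restrict_eq_smul_cond P hp, lintegral_smul_measure, smul_eq_mul]
      exact ENNReal.mul_lt_top (measure_lt_top _ _) h1
  · rw [setLIntegral_congr_fun (g := fun _ => w 0) hs.compl
      (fun ω hω => by rw [Nat.eq_zero_of_not_pos hω]), setLIntegral_const]
    exact ENNReal.mul_lt_top h0 (measure_lt_top _ _)

lemma integral_eq_add_cond_pos (hy : Measurable y) {g : ℕ → ℝ}
    (hg : Integrable (fun ω => g (y ω)) (P[|{ω | 0 < y ω}])) :
    Integrable (fun ω => g (y ω)) P ∧
      ∫ ω, g (y ω) ∂P = P.real {ω | y ω = 0} * g 0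
        + P.real {ω | 0 < y ω} * ∫ ω, g (y ω) ∂(P[|{ω | 0 < y ω}]) := by
  have hs : MeasurableSet {ω | 0 < y ω} := hy measurableSet_Ioi
  have hc : {ω | 0 < y ω}ᶜ = {ω | y ω = 0} := by ext ω; simp
  have hint : Integrable (fun ω => g (y ω)) P := by
    refine ⟨((measurable_of_countable g).comp hy).aestronglyMeasurable, ?_⟩
    exact lintegral_lt_top_of_cond_pos hy (w := fun k => ‖g k‖ₑ) enorm_lt_top hg.2
  refine ⟨hint, ?_⟩
  rw [← integral_add_compl hs hint, hc, add_comm]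
  congr 1
  · rw [setIntegral_congr_fun (s := {ω | y ω = 0}) (g := fun _ => g 0) (hc ▸ hs.compl)
      (fun ω hω => congrArg g hω), setIntegral_const, smul_eq_mul]
  · by_cases hp : P {ω | 0 < y ω} = 0
    · rw [Measure.restrict_eq_zero.2 hp, integral_zero_measure, measureReal_def, hp]; simp
    · rw [restrict_eq_smul_cond P hp, integral_smul_measure, measureReal_def, smul_eq_mul]

/-- A negative logarithmic moment in the extended real numbers, of a coefficient which is bounded
away from zero, yields a finite rate of contraction with negative expectation. -/
lemma exists_rate_of_extExpectation (hy : Measurable y) {L : ℕ → ℝ≥0∞} {δ : ℝ} (hδ : 0 < δ)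
    (hL : ∀ k, ENNReal.ofReal δ ≤ L k)
    (h : (P {ω | y ω = 0} : EReal) * ENNReal.log (L 0)
      + (P {ω | 0 < y ω} : EReal)
        * extExpectation (P[|{ω | 0 < y ω}]) (fun ω => ENNReal.log (L (y ω))) < 0) :
    ∃ g : ℕ → ℝ, Integrable (fun ω => g (y ω)) P ∧ ∫ ω, g (y ω) ∂P < 0 ∧
      ∀ᵐ ω ∂P, L (y ω) ≤ ENNReal.ofReal (Real.exp (g (y ω))) := by
  let l : ℕ → EReal := fun k => ENNReal.log (L k)
  have hd : ∀ k, ((Real.log δ : ℝ) : EReal) ≤ l k := fun k => by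
    rw [← ENNReal.log_ofReal_of_pos hδ]; exact ENNReal.log_le_log (hL k)
  have hbot : ∀ k, l k ≠ ⊥ := fun k => ((EReal.bot_lt_coe _).trans_le (hd k)).ne'
  have hle : ∀ k, l k ≠ ⊤ → L k ≤ ENNReal.ofReal (Real.exp (l k).toReal) := by
    intro k hk
    rw [← ENNReal.log_le_log_iff, ENNReal.log_ofReal_of_pos (Real.exp_pos _), Real.log_exp,
      EReal.coe_toReal hk (hbot k)]
  have hreal : ∀ s : Set Ω, ((P s : ℝ≥0∞) : EReal) = ((P.real s : ℝ) : EReal) := fun s => by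
    rw [measureReal_def, EReal.coe_ennreal_toReal (measure_ne_top _ _)]
  have hrpos : ∀ s : Set Ω, P s ≠ 0 → 0 < P.real s := fun s hs =>
    ENNReal.toReal_pos hs (measure_ne_top _ _)
  rw [hreal, hreal] at h
  change (P.real {ω | y ω = 0} : EReal) * l 0 + (P.real {ω | 0 < y ω} : EReal)
    * extExpectation (P[|{ω | 0 < y ω}]) (fun ω => l (y ω)) < 0 at h
  -- Needed because `⊥ + ⊤ = ⊥` in `EReal`: otherwise a negative sum would not exclude an infinite
  -- conditional expectation.
  have hA : (P.real {ω | y ω = 0} : EReal) * l 0 ≠ ⊥ := by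
    by_cases hq : P {ω | y ω = 0} = 0
    · simp [measureReal_def, hq]
    · rcases eq_or_ne (l 0) ⊤ with h0 | h0
      · rw [h0, EReal.coe_mul_top_of_pos (hrpos _ hq)]; exact top_ne_bot
      · rw [← EReal.coe_toReal h0 (hbot 0), ← EReal.coe_mul]; exact EReal.coe_ne_bot _
  have hcond : ∃ e : ℝ, (P.real {ω | 0 < y ω} : EReal)
      * extExpectation (P[|{ω | 0 < y ω}]) (fun ω => l (y ω)) = e ∧
      (P {ω | 0 < y ω} ≠ 0 → ∀ᵐ ω ∂(P[|{ω | 0 < y ω}]), l (y ω) ≠ ⊤) ∧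
      Integrable (fun ω => (l (y ω)).toReal) (P[|{ω | 0 < y ω}]) ∧
      e = P.real {ω | 0 < y ω} * ∫ ω, (l (y ω)).toReal ∂(P[|{ω | 0 < y ω}]) := by
    by_cases hp : P {ω | 0 < y ω} = 0
    -- Conditioning on a null event gives the zero measure, and `0 * ⊤ = 0`, so the term disappears.
    · refine ⟨0, by simp [measureReal_def, hp], fun h => absurd hp h, ?_, by
        simp [measureReal_def, hp]⟩
      rw [cond_eq_zero_of_meas_eq_zero hp]
      exact integrable_zero_measure
    · obtain ⟨h1, h2, h3⟩ := extExpectation_eq_integral (ν := P[|{ω | 0 < y ω}]) hy hd (by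
        intro htop
        rw [htop, EReal.coe_mul_top_of_pos (hrpos _ hp), EReal.add_top_of_ne_bot hA] at h
        exact not_top_lt h)
      exact ⟨_, by rw [h3, ← EReal.coe_mul], fun _ => h1, h2, rfl⟩
  obtain ⟨e, he, htop, hint, heq⟩ := hcond
  rw [he] at h
  have h0top : P {ω | y ω = 0} ≠ 0 → l 0 ≠ ⊤ := by
    intro hq h0
    rw [h0, EReal.coe_mul_top_of_pos (hrpos _ hq), EReal.top_add_coe] at h
    exact not_top_lt h
  have hA' : (P.real {ω | y ω = 0} : EReal) * l 0
      = ((P.real {ω | y ω = 0} * (l 0).toReal : ℝ) : EReal) := by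
    by_cases hq : P {ω | y ω = 0} = 0
    · simp [measureReal_def, hq]
    · rw [EReal.coe_mul, EReal.coe_toReal (h0top hq) (hbot 0)]
  rw [hA', ← EReal.coe_add, ← EReal.coe_zero, EReal.coe_lt_coe_iff, heq] at h
  obtain ⟨hi, hi'⟩ := integral_eq_add_cond_pos hy (g := fun k => (l k).toReal) hint
  exact ⟨fun k => (l k).toReal, hi, hi' ▸ h,
    (ae_of_cond_pos hy (p := fun k => l k ≠ ⊤) h0top htop).mono fun ω hω => hle _ hω⟩

end Moments

/-! ### Invertibility of the filter -/

section Filter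

variable {Θ : Set Param}

/-- The score, evaluated along a continuous function of the parameter. -/
noncomputable def scoreMap (hadm : ∀ θ ∈ Θ, Admissible θ) (k : ℕ) (h : C(Θ, ℝ)) : C(Θ, ℝ) where
  toFun θ := score k (h θ) θ
  continuous_toFun := (continuous_score hadm k).comp (h.continuous.prodMk continuous_id)

lemma continuous_update (hadm : ∀ θ ∈ Θ, Admissible θ) (k : ℕ) :
    Continuous fun p : ℝ × Θ => update k p.1 p.2 := by
  have h (j : Fin 5) : Continuous fun p : ℝ × Θ => (p.2 : Param) j :=
    (continuous_apply j).comp (continuous_subtype_val.comp continuous_snd)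
  exact ((h 2).add ((h 3).mul continuous_fst)).add ((h 4).mul (continuous_score hadm k))

/-- The update of the filter as a map of continuous functions of the parameter. -/
noncomputable def updateMap (hadm : ∀ θ ∈ Θ, Admissible θ) (k : ℕ) (h : C(Θ, ℝ)) : C(Θ, ℝ) where
  toFun θ := update k (h θ) θ
  continuous_toFun := (continuous_update hadm k).comp (h.continuous.prodMk continuous_id)

/-- The translation by `1` reflects that the filter starts at time `1`, so that the first
observation it uses is `x 1`. -/
lemma filter_eq_iterState {Ω : Type*} (hadm : ∀ θ ∈ Θ, Admissible θ) (x : ℤ → Ω → ℕ)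
    (f₁ : C(Θ, ℝ)) (ω : Ω) (n : ℕ) (θ : Θ) :
    filter x f₁ n ω θ = iterState (updateMap hadm) (translate 1 fun i => x i ω) n f₁ θ := by
  induction n with
  | zero => rfl
  | succ n ih => simp only [filter, iterState, ih]; rfl

variable [CompactSpace Θ]

lemma continuous_updateMap (hadm : ∀ θ ∈ Θ, Admissible θ) (k : ℕ) :
    Continuous (updateMap hadm k) :=
  ContinuousMap.continuous_of_continuous_uncurry _
    ((continuous_update hadm k).comp (continuous_eval.prodMk continuous_snd))

lemma dist_updateMap_le (hadm : ∀ θ ∈ Θ, Admissible θ) {k : ℕ} {K : ℝ} (hK0 : 0 ≤ K)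
    (hK : contraction Θ k ≤ ENNReal.ofReal K) (h₁ h₂ : C(Θ, ℝ)) :
    dist (updateMap hadm k h₁) (updateMap hadm k h₂) ≤ K * dist h₁ h₂ := by
  rw [ContinuousMap.dist_le (by positivity)]
  intro θ
  refine (abs_update_sub_le hadm hK0 hK θ.2 _ _).trans ?_
  exact mul_le_mul_of_nonneg_left (ContinuousMap.dist_apply_le_dist (f := h₁) (g := h₂) θ) hK0

lemma supScore_eq (hadm : ∀ θ ∈ Θ, Admissible θ) (f₁ : C(Θ, ℝ)) (k : ℕ) :
    supScore f₁ k = ENNReal.ofReal ‖scoreMap hadm k f₁‖ := by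
  rw [ofReal_norm, ContinuousMap.enorm_eq_iSup_enorm]
  rfl

/-- The displacement is affine in the score, with coefficients bounded on the compact set `Θ`;
`posLog` turns these into an additive constant. -/
lemma exists_posLog_dist_updateMap_le (hadm : ∀ θ ∈ Θ, Admissible θ) (f₁ : C(Θ, ℝ)) :
    ∃ C : ℝ, ∀ k, ENNReal.ofReal (Real.posLog (dist (updateMap hadm k f₁) f₁))
      ≤ ENNReal.ofReal C + logPlus (supScore f₁ k) := by
  have hc (j : Fin 5) : Continuous fun θ : Θ => (θ : Param) j :=
    (continuous_apply j).comp continuous_subtype_val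
  let A : C(Θ, ℝ) := ⟨fun θ => const θ + autoreg θ * f₁ θ - f₁ θ,
    ((hc 2).add ((hc 3).mul f₁.continuous)).sub f₁.continuous⟩
  let B : C(Θ, ℝ) := ⟨fun θ => scoreCoef θ, hc 4⟩
  refine ⟨Real.log 2 + Real.posLog ‖A‖ + Real.posLog ‖B‖, fun k => ?_⟩
  have heq : updateMap hadm k f₁ - f₁ = A + B * scoreMap hadm k f₁ := by
    ext θ
    change const θ + autoreg θ * f₁ θ + scoreCoef θ * score k (f₁ θ) θ - f₁ θ
      = const θ + autoreg θ * f₁ θ - f₁ θ + scoreCoef θ * score k (f₁ θ) θ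
    ring
  have hle : dist (updateMap hadm k f₁) f₁ ≤ ‖A‖ + ‖B‖ * ‖scoreMap hadm k f₁‖ := by
    rw [dist_eq_norm, heq]
    exact (norm_add_le _ _).trans (add_le_add le_rfl (norm_mul_le _ _))
  rw [supScore_eq hadm, logPlus_ofReal _ (norm_nonneg _)]
  refine (ENNReal.ofReal_le_ofReal ?_).trans ENNReal.ofReal_add_le
  refine (Real.posLog_le_posLog dist_nonneg hle).trans (Real.posLog_add.trans ?_)
  linarith [Real.posLog_mul (x := ‖B‖) (y := ‖scoreMap hadm k f₁‖)]

variable {Ω : Type*} [MeasurableSpace Ω] {P : Measure Ω} [IsProbabilityMeasure P]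

omit [CompactSpace Θ] in
lemma exists_rate_contraction (hadm : ∀ θ ∈ Θ, Admissible θ) {y : Ω → ℕ} (hy : Measurable y)
    (h : (P {ω | y ω = 0} : EReal) * logContraction Θ 0
      + (P {ω | 0 < y ω} : EReal)
        * extExpectation (P[|{ω | 0 < y ω}]) (fun ω => logContraction Θ (y ω)) < 0) :
    ∃ g : ℕ → ℝ, Integrable (fun ω => g (y ω)) P ∧ ∫ ω, g (y ω) ∂P < 0 ∧
      ∀ᵐ ω ∂P, contraction Θ (y ω) ≤ ENNReal.ofReal (Real.exp (g (y ω))) := by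
  by_cases htriv : ∀ θ ∈ Θ, autoreg θ = 0 ∧ scoreCoef θ = 0
  -- Here the coefficient is zero and its logarithm `⊥`, so any negative constant is a valid rate.
  -- This also covers empty `Θ`.
  · refine ⟨fun _ => -1, integrable_const _, by simp, ae_of_all _ fun ω => ?_⟩
    refine iSup₂_le fun f θ => ?_
    simp [htriv θ θ.2]
  · push Not at htriv
    obtain ⟨θ, hθ, hne⟩ := htriv
    obtain ⟨δ, hδ, hL⟩ := exists_pos_le_contraction hadm hθ (fun h => hne h.1 h.2)
    exact exists_rate_of_extExpectation hy hδ hL h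

lemma isContractingOnAverage_updateMap (hadm : ∀ θ ∈ Θ, Admissible θ) {x : ℤ → Ω → ℕ}
    (hx : IsStationaryErgodic x P) (f₁ : C(Θ, ℝ)) (h_i : logPlus (supScore f₁ 0) < ⊤)
    (h_ii : ∫⁻ ω, logPlus (supScore f₁ (x 1 ω)) ∂(P[|{ω | 0 < x 1 ω}]) < ⊤)
    {g : ℕ → ℝ} (hint : Integrable (fun ω => g (x 1 ω)) P) (hneg : ∫ ω, g (x 1 ω) ∂P < 0)
    (hg : ∀ᵐ ω ∂P, contraction Θ (x 1 ω) ≤ ENNReal.ofReal (Real.exp (g (x 1 ω)))) :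
    IsContractingOnAverage (updateMap hadm) g f₁ (P.map fun ω i => x i ω) := by
  have hpres : MeasurePreserving (fun ω => translate 1 fun i => x i ω) P
      (P.map fun ω i => x i ω) := measurePreserving_translate_comp hx.isStationary 1
  have hmg : Measurable g := measurable_of_countable g
  have hgm : Measurable fun u : ℤ → ℕ => g (u 0) := hmg.comp (measurable_pi_apply 0)
  have hae {p : ℕ → Prop} (hp : ∀ᵐ ω ∂P, p (x 1 ω)) :
      ∀ᵐ u ∂(P.map fun ω i => x i ω), p (u 0) := by
    have hs : MeasurableSet {u : ℤ → ℕ | p (u 0)} :=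
      measurable_pi_apply (0 : ℤ) (MeasurableSet.of_discrete (s := {k | p k}))
    rw [← hpres.map_eq, ae_map_iff hpres.measurable.aemeasurable hs]
    simpa using hp
  have hpl : Measurable fun u : ℤ → ℕ => Real.posLog (dist (updateMap hadm (u 0) f₁) f₁) :=
    (measurable_of_countable fun k => Real.posLog (dist (updateMap hadm k f₁) f₁)).comp
      (measurable_pi_apply 0)
  refine ⟨hx.2, ?_, continuous_updateMap hadm, hmg, ?_, ?_, ?_, ?_⟩
  · exact measurable_from_prod_countable_right fun k => (continuous_updateMap hadm k).measurable
  · rw [← hpres.integrable_comp hgm.aestronglyMeasurable]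
    exact hint
  · rw [← hpres.map_eq, integral_map hpres.measurable.aemeasurable hgm.aestronglyMeasurable]
    exact hneg
  · refine hae (p := fun k => ∀ a b, dist (updateMap hadm k a) (updateMap hadm k b)
      ≤ Real.exp (g k) * dist a b) (hg.mono fun ω hω a b => ?_)
    exact dist_updateMap_le hadm (Real.exp_pos _).le hω a b
  · rw [← hpres.integrable_comp hpl.aestronglyMeasurable]
    obtain ⟨C, hC⟩ := exists_posLog_dist_updateMap_le hadm f₁
    refine ⟨(hpl.comp hpres.measurable).aestronglyMeasurable, ?_⟩
    rw [hasFiniteIntegral_iff_norm]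
    have hlog := lintegral_lt_top_of_cond_pos (hx.1 1)
      (w := fun k => logPlus (supScore f₁ k)) h_i h_ii
    refine lt_of_le_of_lt (lintegral_mono
      (g := fun ω => ENNReal.ofReal C + logPlus (supScore f₁ (x 1 ω))) fun ω => ?_) ?_
    · rw [Function.comp_apply, Real.norm_of_nonneg Real.posLog_nonneg]
      exact hC (x 1 ω)
    · rw [lintegral_add_left measurable_const, lintegral_const, measure_univ, mul_one]
      exact ENNReal.add_lt_top.2 ⟨ENNReal.ofReal_lt_top, hlog⟩

omit [MeasurableSpace Ω] in
lemma supDist_eq (hadm : ∀ θ ∈ Θ, Admissible θ) (x : ℤ → Ω → ℕ) (f₁ : C(Θ, ℝ))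
    (g : ℤ → Ω → C(Θ, ℝ)) (n : ℕ) (ω : Ω) :
    supDist x f₁ g n ω = ENNReal.ofReal
      (dist (iterState (updateMap hadm) (translate 1 fun i => x i ω) n f₁) (g (n + 1) ω)) := by
  rw [← edist_dist, ContinuousMap.edist_eq_iSup, supDist]
  refine iSup_congr fun θ => ?_
  rw [filter_eq_iterState hadm, edist_eq_enorm_sub]

/-- A filter which is contracting on the average is uniformly invertible. -/
theorem isUniformlyInvertible_of_isContractingOnAverage (hadm : ∀ θ ∈ Θ, Admissible θ)
    {x : ℤ → Ω → ℕ} (hx : IsStationaryErgodic x P) {f₁ : C(Θ, ℝ)} {g : ℕ → ℝ}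
    (h : IsContractingOnAverage (updateMap hadm) g f₁ (P.map fun ω i => x i ω)) :
    IsUniformlyInvertible P x f₁ := by
  have hXp := hx.isStationary.measurable_path
  have : IsProbabilityMeasure (P.map fun ω i => x i ω) :=
    Measure.isProbabilityMeasure_map hXp.aemeasurable
  obtain ⟨F, hF, hsol⟩ := h.exists_stationary_solution
  have hrec : ∀ᵐ ω ∂P, ∀ i, F (translate (i + 1) fun j => x j ω)
      = updateMap hadm (x i ω) (F (translate i fun j => x j ω)) :=
    ae_of_ae_map hXp.aemeasurable hsol
  obtain ⟨ε, hε, hfwd⟩ := h.exists_forward_rate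
  -- With `γ = exp (ε / 2)`, half of the forward rate `ε` is spent on `γ ^ n` and the other half
  -- still gives geometric decay.
  have hconv : ∀ᵐ ω ∂P, Tendsto (fun n : ℕ => ENNReal.ofReal (Real.exp (ε / 2) ^ n)
      * supDist x f₁ (fun i ω => F (translate i fun j => x j ω)) n ω) atTop (𝓝 0) := by
    have h1 := (measurePreserving_translate_comp hx.isStationary 1).quasiMeasurePreserving.ae hfwd
    filter_upwards [h1, hrec, ae_of_ae_map hXp.aemeasurable h.ae_dist_le] with ω ⟨C, hC⟩ hω hlip
    set D := dist f₁ (F (translate 1 fun j => x j ω))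
    have hbound : ∀ n : ℕ, ENNReal.ofReal (Real.exp (ε / 2) ^ n)
        * supDist x f₁ (fun i ω => F (translate i fun j => x j ω)) n ω
        ≤ ENNReal.ofReal (Real.exp C * D * Real.exp (-(ε / 2)) ^ n) := by
      intro n
      rw [supDist_eq hadm, ← ENNReal.ofReal_mul (by positivity)]
      refine ENNReal.ofReal_le_ofReal ?_
      have e1 := eq_iterState (Φ := updateMap hadm) (u := fun k => x k ω)
        (y := fun i => F (translate i fun j => x j ω)) hω 1 n
      rw [add_comm (n : ℤ) 1, e1]
      have e2 := (dist_iterState_le (g := g) (u := translate 1 fun k => x k ω)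
        (fun _ a b => hlip _ a b) n f₁ (F (translate 1 fun j => x j ω))).trans
        (mul_le_mul_of_nonneg_right (Real.exp_le_exp.2 (hC n)) dist_nonneg)
      refine (mul_le_mul_of_nonneg_left e2 (by positivity)).trans_eq ?_
      rw [← Real.exp_nat_mul, ← Real.exp_nat_mul, ← mul_assoc, ← Real.exp_add,
        mul_right_comm, ← Real.exp_add]
      congr 2
      ring
    refine tendsto_of_tendsto_of_tendsto_of_le_of_le tendsto_const_nhds ?_
      (fun _ => zero_le) hbound
    have h2 := ((tendsto_pow_atTop_nhds_zero_of_lt_one (Real.exp_pos (-(ε / 2))).le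
      (Real.exp_lt_one_iff.2 (by linarith))).const_mul (Real.exp C * D))
    rw [mul_zero] at h2
    simpa using ENNReal.tendsto_ofReal h2
  have hstat := hx.factor hF
  refine ⟨fun i ω => F (translate i fun j => x j ω), hstat, ?_, ?_,
    ⟨Real.exp (ε / 2), Real.one_lt_exp_iff.2 (half_pos hε), hconv⟩, ?_, ?_⟩
  · simpa using hx.factor ((measurable_pi_apply (0 : ℤ)).prodMk hF)
  · exact hrec.mono fun ω hω i θ => DFunLike.congr_fun (hω i) θ
  · intro y hy hlim
    have hy0 : ∀ᵐ ω ∂P, Tendsto (fun n : ℕ =>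
        dist (y n ω) (F (translate n fun j => x j ω))) atTop (𝓝 0) := by
      filter_upwards [hconv, hlim] with ω h1 h2
      have h1' : Tendsto (fun n : ℕ =>
          supDist x f₁ (fun i ω => F (translate i fun j => x j ω)) n ω) atTop (𝓝 0) := by
        refine tendsto_of_tendsto_of_tendsto_of_le_of_le tendsto_const_nhds h1
          (fun _ => zero_le) fun n => ?_
        refine le_mul_of_one_le_left zero_le (ENNReal.one_le_ofReal.2 ?_)
        exact one_le_pow₀ (Real.one_le_exp (half_pos hε).le)
      have h3 : Tendsto (fun n : ℕ => edist (y ((n + 1 : ℕ) : ℤ) ω)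
          (F (translate ((n + 1 : ℕ) : ℤ) fun j => x j ω))) atTop (𝓝 0) := by
        have h4 := h2.add h1'
        rw [add_zero] at h4
        refine tendsto_of_tendsto_of_tendsto_of_le_of_le tendsto_const_nhds h4
          (fun _ => zero_le) fun n => ?_
        simp only [supDist_eq hadm, ← edist_dist, Nat.cast_succ]
        exact edist_triangle_left _ _ _
      rw [← tendsto_add_atTop_iff_nat 1]
      refine ((ENNReal.tendsto_toReal ENNReal.zero_ne_top).comp h3).congr fun n => ?_
      rw [Function.comp_apply, edist_dist, ENNReal.toReal_ofReal dist_nonneg]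
    exact ae_eq_of_tendsto_dist hF hy hy0
  · intro y hy hys
    refine h.ae_eq_of_solutions hx.1 hy hstat.isStationary ?_ hrec
    exact hys.mono fun ω hω i => ContinuousMap.ext fun θ => hω i θ

end Filter

end ZIACD

theorem proposition1 {Ω : Type*} [MeasurableSpace Ω] (P : Measure Ω) [IsProbabilityMeasure P]
    (x : ℤ → Ω → ℕ) (hx : ZIACD.IsStationaryErgodic x P)
    (Θ : Set ZIACD.Param) (hΘ : IsCompact Θ) (hadm : ∀ θ ∈ Θ, ZIACD.Admissible θ)
    (f₁ : C(Θ, ℝ))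
    (h_i : ZIACD.logPlus (ZIACD.supScore f₁ 0) < ⊤)
    (h_ii : ∫⁻ ω, ZIACD.logPlus (ZIACD.supScore f₁ (x 1 ω)) ∂(P[|{ω | 0 < x 1 ω}]) < ⊤)
    (h_iii : (P {ω | x 1 ω = 0} : EReal) * ZIACD.logContraction Θ 0
      + (P {ω | 0 < x 1 ω} : EReal)
        * ZIACD.extExpectation (P[|{ω | 0 < x 1 ω}]) (fun ω => ZIACD.logContraction Θ (x 1 ω))
      < 0) :
    ZIACD.IsUniformlyInvertible P x f₁ := by
  have : CompactSpace Θ := isCompact_iff_compactSpace.1 hΘ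
  obtain ⟨g, hint, hneg, hg⟩ := ZIACD.exists_rate_contraction hadm (hx.1 1) h_iii
  exact ZIACD.isUniformlyInvertible_of_isContractingOnAverage hadm hx
    (ZIACD.isContractingOnAverage_updateMap hadm hx f₁ h_i h_ii hint hneg hg)
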